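/- Let $L_2$ be the two-sorted language of second-order arithmetic, with number variables $x,y,\dots$, set variables $X,Y,\dots$, the symbols $0,1,+,\cdot,\le,=$ on numbers and $\in$ between numbers and sets. A formula is $\Delta^0_0$ if all its quantifiers are bounded number quantifiers (number and set parameters are allowed), and $\Sigma^0_n$ if it consists of $n$ alternating blocks of number quantifiers, the first one existential, followed by a $\Delta^0_0$ formula. For $n\in\omega$, $\Sigma^0_n\text{-}\mathsf{IND}$ is the scheme of all universal closures of $$\varphi(0)\wedge\forall x\,(\varphi(x)\Rightarrow\varphi(x+1))\Rightarrow\forall x\,\varphi(x),\qquad \varphi\in\Sigma^0_n .$$ The theory $\mathsf{RCA}_0$ consists of axioms saying that the number sort is the non-negative part of a discretely ordered ring, the scheme $\Sigma^0_1\text{-}\mathsf{IND}$, and $\Delta^0_1$-comprehension, i.e. all universal closures of $$\forall x\,(\varphi(x)\Leftrightarrow\neg\psi(x))\Rightarrow\exists X\,\forall x\,(x\in X\Leftrightarrow\varphi(x)),\qquad \varphi,\psi\in\Sigma^0_1,\ X\text{ not free in }\varphi .$$ Write $\mathbb N$ for the number sort. Code pairs by $(a,b)=(a+b)^2+a$,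 and code relations and functions as sets of (codes of) tuples; a set is finite if it is bounded and infinite if it is unbounded. Ordered Ramsey's Theorem for pairs is the following sentence of $L_2$: for every finite set $P$, every partial order $\preceq$ on $P$ and every colouring $C$ assigning to each pair $i<j$ of numbers a colour $C(i,j)\in P$, if $C(i,j)\succeq C(i,k)$ for all $i<j<k$, then there is an infinite set $I\subseteq\mathbb N$ that is homogeneous for $C$, i.e. $C(i,j)=C(i',j')$ for all $i<j$ in $I$ and all $i'<j'$ in $I$. Lemma. The theory $\mathsf{RCA}_0+\Sigma^0_2\text{-}\mathsf{IND}$ proves (in classical two-sorted first-order logic with equality) Ordered Ramsey's Theorem for pairs. -/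

import Mathlib

namespace SOA

/-! ### The two-sorted language of second-order arithmetic (de Bruijn indices)

Number variables and set variables are indexed separately by `ℕ`. A number quantifier binds the
number variable `0` and a set quantifier binds the set variable `0`; the other variables of that
sort are shifted by one under the quantifier. -/

/-- Number terms, over `0`, `1`, `+`, `·`. -/
inductive NTerm : Type
  | var : ℕ → NTerm
  | zero : NTerm
  | one : NTerm
  | add : NTerm → NTerm → NTerm
  | mul : NTerm → NTerm → NTerm

/-- Formulas. The only set terms are the set variables: `mem t X` says that `t` is an element of
the set variable of index `X`. -/
inductive Fml : Type
  | eq : NTerm → NTerm → Fml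
  | le : NTerm → NTerm → Fml
  | mem : NTerm → ℕ → Fml
  | fal : Fml
  | imp : Fml → Fml → Fml
  | allN : Fml → Fml
  | allS : Fml → Fml

namespace NTerm

/-- Simultaneous substitution of terms for number variables. -/
def subst (σ : ℕ → NTerm) : NTerm → NTerm
  | var n => σ n
  | zero => zero
  | one => one
  | add t u => add (t.subst σ) (u.subst σ)
  | mul t u => mul (t.subst σ) (u.subst σ)

/-- Add one to every number variable. -/
def shift (t : NTerm) : NTerm := t.subst fun n => var (n + 1)

/-- The code `(a + b)² + a` of the ordered pair `(a, b)`. -/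
def pair (a b : NTerm) : NTerm := add (mul (add a b) (add a b)) a

/-- The code of the triple `((a, b), c)`. -/
def triple (a b c : NTerm) : NTerm := pair (pair a b) c

end NTerm

open NTerm

/-- Prepend a value to a sequence: `scons a f` is `a, f 0, f 1, …`. -/
def scons {α : Type} (a : α) (f : ℕ → α) : ℕ → α
  | 0 => a
  | n + 1 => f n

namespace Fml

/-- Capture-avoiding simultaneous substitution of number terms for number variables and of set
variables for set variables. -/
def subst : (ℕ → NTerm) → (ℕ → ℕ) → Fml → Fml
  | σ, _, eq t u => eq (t.subst σ) (u.subst σ)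
  | σ, _, le t u => le (t.subst σ) (u.subst σ)
  | σ, τ, mem t X => mem (t.subst σ) (τ X)
  | _, _, fal => fal
  | σ, τ, imp φ ψ => imp (subst σ τ φ) (subst σ τ ψ)
  | σ, τ, allN φ => allN (subst (scons (var 0) fun n => (σ n).shift) τ φ)
  | σ, τ, allS φ => allS (subst σ (scons 0 fun n => τ n + 1) φ)

/-- Add one to every free number variable. -/
def shiftN (φ : Fml) : Fml := φ.subst (fun n => var (n + 1)) id

/-- Add one to every free set variable. -/
def shiftS (φ : Fml) : Fml := φ.subst var (fun n => n + 1)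

/-- Replace the number variable `0` by the term `t`, lowering the other number variables. -/
def instN (t : NTerm) (φ : Fml) : Fml := φ.subst (scons t var) id

/-- Replace the set variable `0` by the set variable `k`, lowering the other set variables. -/
def instS (k : ℕ) (φ : Fml) : Fml := φ.subst var (scons k id)

/-- From `φ(x)` to `φ(x + 1)`, where `x` is the number variable `0`. -/
def atSucc (φ : Fml) : Fml := φ.subst (scons (add (var 0) one) fun n => var (n + 1)) id

def neg (φ : Fml) : Fml := imp φ fal
def and (φ ψ : Fml) : Fml := neg (imp φ (neg ψ))
def or (φ ψ : Fml) : Fml := imp (neg φ) ψ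
def iff (φ ψ : Fml) : Fml := and (imp φ ψ) (imp ψ φ)
def exN (φ : Fml) : Fml := neg (allN (neg φ))
def exS (φ : Fml) : Fml := neg (allS (neg φ))
def lt (t u : NTerm) : Fml := and (le t u) (neg (eq t u))

/-- `∀ x ≤ t, φ`, where `x` does not occur in `t`. -/
def ballN (t : NTerm) (φ : Fml) : Fml := allN (imp (le (var 0) t.shift) φ)

/-- `∃ x ≤ t, φ`, where `x` does not occur in `t`. -/
def bexN (t : NTerm) (φ : Fml) : Fml := exN (and (le (var 0) t.shift) φ)

end Fml

open Fml

/-! ### Provability: natural deduction for classical two-sorted logic with equality -/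

/-- `Prf T Γ φ`: the formula `φ` is derivable from the axioms `T` and the open assumptions `Γ`.
The eigenvariable condition of the generalization rules concerns the assumptions `Γ` only, so that
an axiom of `T` with free variables amounts to its universal closure. -/
inductive Prf (T : Set Fml) : List Fml → Fml → Prop
  | ax {Γ : List Fml} {φ : Fml} : φ ∈ T → Prf T Γ φ
  | hyp {Γ : List Fml} {φ : Fml} : φ ∈ Γ → Prf T Γ φ
  | impI {Γ : List Fml} {φ ψ : Fml} : Prf T (φ :: Γ) ψ → Prf T Γ (imp φ ψ)
  | impE {Γ : List Fml} {φ ψ : Fml} : Prf T Γ (imp φ ψ) → Prf T Γ φ → Prf T Γ ψ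
  | raa {Γ : List Fml} {φ : Fml} : Prf T (neg φ :: Γ) fal → Prf T Γ φ
  | allNI {Γ : List Fml} {φ : Fml} : Prf T (Γ.map shiftN) φ → Prf T Γ (allN φ)
  | allNE {Γ : List Fml} {φ : Fml} (t : NTerm) : Prf T Γ (allN φ) → Prf T Γ (φ.instN t)
  | allSI {Γ : List Fml} {φ : Fml} : Prf T (Γ.map shiftS) φ → Prf T Γ (allS φ)
  | allSE {Γ : List Fml} {φ : Fml} (k : ℕ) : Prf T Γ (allS φ) → Prf T Γ (φ.instS k)
  | eqRefl {Γ : List Fml} (t : NTerm) : Prf T Γ (eq t t)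
  | eqSubst {Γ : List Fml} {t u : NTerm} (φ : Fml) :
      Prf T Γ (eq t u) → Prf T Γ (φ.instN t) → Prf T Γ (φ.instN u)

/-- The theory `T` proves `φ`. -/
def Proves (T : Set Fml) (φ : Fml) : Prop := Prf T [] φ

/-! ### The arithmetical hierarchy -/

/-- `Δ⁰₀` formulas: all quantifiers are bounded number quantifiers (set parameters allowed). -/
inductive IsDelta0 : Fml → Prop
  | eq (t u : NTerm) : IsDelta0 (eq t u)
  | le (t u : NTerm) : IsDelta0 (le t u)
  | mem (t : NTerm) (X : ℕ) : IsDelta0 (mem t X)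
  | fal : IsDelta0 fal
  | imp {φ ψ : Fml} : IsDelta0 φ → IsDelta0 ψ → IsDelta0 (imp φ ψ)
  | ball (t : NTerm) {φ : Fml} : IsDelta0 φ → IsDelta0 (ballN t φ)
  | bex (t : NTerm) {φ : Fml} : IsDelta0 φ → IsDelta0 (bexN t φ)

/-- `IsHier true n` is the class `Σ⁰ₙ` and `IsHier false n` the class `Π⁰ₙ`: `n` alternating
blocks of number quantifiers, starting with `∃` resp. `∀`, in front of a `Δ⁰₀` formula. -/
inductive IsHier : Bool → ℕ → Fml → Prop
  | zero (b : Bool) {φ : Fml} : IsDelta0 φ → IsHier b 0 φ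
  | ofPi {n : ℕ} {φ : Fml} : IsHier false n φ → IsHier true (n + 1) φ
  | ex {n : ℕ} {φ : Fml} : IsHier true (n + 1) φ → IsHier true (n + 1) (exN φ)
  | ofSigma {n : ℕ} {φ : Fml} : IsHier true n φ → IsHier false (n + 1) φ
  | all {n : ℕ} {φ : Fml} : IsHier false (n + 1) φ → IsHier false (n + 1) (allN φ)

/-- `φ` is a `Σ⁰ₙ` formula. -/
def IsSigma (n : ℕ) (φ : Fml) : Prop := IsHier true n φ

/-! ### The axioms

Free variables of an axiom are its parameters; they are understood to be universally quantified. -/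

/-- The number sort is the non-negative part of a discretely ordered ring. -/
inductive BasicAxiom : Fml → Prop
  | add_assoc : BasicAxiom
      (eq (add (add (var 0) (var 1)) (var 2)) (add (var 0) (add (var 1) (var 2))))
  | add_comm : BasicAxiom (eq (add (var 0) (var 1)) (add (var 1) (var 0)))
  | add_zero : BasicAxiom (eq (add (var 0) zero) (var 0))
  | mul_assoc : BasicAxiom
      (eq (mul (mul (var 0) (var 1)) (var 2)) (mul (var 0) (mul (var 1) (var 2))))
  | mul_comm : BasicAxiom (eq (mul (var 0) (var 1)) (mul (var 1) (var 0)))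
  | mul_one : BasicAxiom (eq (mul (var 0) one) (var 0))
  | mul_zero : BasicAxiom (eq (mul (var 0) zero) zero)
  | mul_add : BasicAxiom
      (eq (mul (var 0) (add (var 1) (var 2))) (add (mul (var 0) (var 1)) (mul (var 0) (var 2))))
  | le_refl : BasicAxiom (le (var 0) (var 0))
  | le_antisymm : BasicAxiom
      (imp (le (var 0) (var 1)) (imp (le (var 1) (var 0)) (eq (var 0) (var 1))))
  | le_trans : BasicAxiom
      (imp (le (var 0) (var 1)) (imp (le (var 1) (var 2)) (le (var 0) (var 2))))
  | le_total : BasicAxiom (or (le (var 0) (var 1)) (le (var 1) (var 0)))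
  | add_lt_add : BasicAxiom
      (imp (lt (var 0) (var 1)) (lt (add (var 0) (var 2)) (add (var 1) (var 2))))
  | mul_lt_mul : BasicAxiom
      (imp (lt (var 0) (var 1))
        (imp (lt zero (var 2)) (lt (mul (var 0) (var 2)) (mul (var 1) (var 2)))))
  | zero_le : BasicAxiom (le zero (var 0))
  | zero_lt_one : BasicAxiom (lt zero one)
  | discrete : BasicAxiom (imp (lt zero (var 0)) (le one (var 0)))
  | subtraction : BasicAxiom
      (imp (le (var 0) (var 1)) (exN (eq (add (var 1) (var 0)) (var 2))))

/-- Induction for `φ(x)`, `x` being the number variable `0`: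
`φ(0) ∧ ∀ x (φ(x) → φ(x + 1)) → ∀ x φ(x)`. -/
def indAxiom (φ : Fml) : Fml :=
  imp (and (φ.instN zero) (allN (imp φ φ.atSucc))) (allN φ)

/-- Comprehension for `φ(x)`, `ψ(x)`, `x` being the number variable `0`:
`∀ x (φ(x) ↔ ¬ ψ(x)) → ∃ X ∀ x (x ∈ X ↔ φ(x))`, where `X` does not occur in `φ`. -/
def comprAxiom (φ ψ : Fml) : Fml :=
  imp (allN (iff φ (neg ψ))) (exS (allN (iff (mem (var 0) 0) φ.shiftS)))

/-- The scheme `Σ⁰ₙ-IND`. -/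
def SigmaIND (n : ℕ) : Set Fml := {χ | ∃ φ, IsSigma n φ ∧ χ = indAxiom φ}

/-- The scheme of `Δ⁰₁` comprehension. -/
def Delta1CA : Set Fml := {χ | ∃ φ ψ, IsSigma 1 φ ∧ IsSigma 1 ψ ∧ χ = comprAxiom φ ψ}

/-- The theory `RCA₀`. -/
def RCA0 : Set Fml := {χ | BasicAxiom χ} ∪ SigmaIND 1 ∪ Delta1CA

/-! ### Ordered Ramsey's Theorem for pairs, as a sentence of second-order arithmetic

The arguments `P`, `R`, `C`, `I` below are indices of set variables. -/

/-- The set `P` is finite, i.e. bounded: `∃ b ∀ x (x ∈ P → x ≤ b)`. -/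
def finiteSet (P : ℕ) : Fml := exN (allN (imp (mem (var 0) P) (le (var 0) (var 1))))

/-- The set `I` is infinite, i.e. unbounded: `∀ b ∃ x (b < x ∧ x ∈ I)`. -/
def infiniteSet (I : ℕ) : Fml := allN (exN (and (lt (var 1) (var 0)) (mem (var 0) I)))

/-- The relation `{(x, y) : pair x y ∈ R}` is a partial order on the set `P`; `pair x y ∈ R` is read
as `x ⪯ y`. -/
def partialOrderOn (P R : ℕ) : Fml :=
  and (allN (imp (mem (var 0) P) (mem (pair (var 0) (var 0)) R)))
    (and
      (allN (allN (imp (mem (var 1) P) (imp (mem (var 0) P)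
        (imp (mem (pair (var 1) (var 0)) R) (imp (mem (pair (var 0) (var 1)) R)
          (eq (var 1) (var 0))))))))
      (allN (allN (allN (imp (mem (var 2) P) (imp (mem (var 1) P) (imp (mem (var 0) P)
        (imp (mem (pair (var 2) (var 1)) R) (imp (mem (pair (var 1) (var 0)) R)
          (mem (pair (var 2) (var 0)) R))))))))))

/-- `C` is a colouring of the pairs `i < j` by elements of `P`: for all `i < j` there is `p ∈ P`
which is the one and only number with `triple i j p ∈ C`. This `p` is the colour `C(i, j)`. -/
def colouring (C P : ℕ) : Fml :=
  allN (allN (imp (lt (var 1) (var 0))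
    (exN (and (mem (var 0) P) (and (mem (triple (var 2) (var 1) (var 0)) C)
      (allN (imp (mem (triple (var 3) (var 2) (var 0)) C) (eq (var 0) (var 1)))))))))

/-- For all `i < j < k`: `C(i, j) ⪰ C(i, k)`. The variables `i, j, k, p, q` have the indices
`4, 3, 2, 1, 0`, with `p = C(i, j)` and `q = C(i, k)`. -/
def orderedColouring (C R : ℕ) : Fml :=
  allN (allN (allN (allN (allN
    (imp (lt (var 4) (var 3)) (imp (lt (var 3) (var 2))
      (imp (mem (triple (var 4) (var 3) (var 1)) C) (imp (mem (triple (var 4) (var 2) (var 0)) C)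
        (mem (pair (var 0) (var 1)) R)))))))))

/-- `C(i, j) = C(i', j')` for all `i < j` in `I` and all `i' < j'` in `I`. The variables
`i, j, i', j', p, q` have the indices `5, 4, 3, 2, 1, 0`, with `p = C(i, j)`, `q = C(i', j')`. -/
def homogeneous (C I : ℕ) : Fml :=
  allN (allN (allN (allN (allN (allN
    (imp (mem (var 5) I) (imp (mem (var 4) I) (imp (lt (var 5) (var 4))
      (imp (mem (var 3) I) (imp (mem (var 2) I) (imp (lt (var 3) (var 2))
        (imp (mem (triple (var 5) (var 4) (var 1)) C)
          (imp (mem (triple (var 3) (var 2) (var 0)) C)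
            (eq (var 1) (var 0)))))))))))))))

/-- Ordered Ramsey's Theorem for pairs. In the premises `P`, `⪯`, `C` have the indices `2, 1, 0`;
under the quantifier `∃ I` the set `I` has index `0` and `C` has index `1`. -/
def orderedRamsey : Fml :=
  allS (allS (allS
    (imp (and (finiteSet 2) (and (partialOrderOn 2 1) (and (colouring 0 2) (orderedColouring 0 1))))
      (exS (and (infiniteSet 0) (homogeneous 1 0))))))

end SOA

/-! By completeness it suffices to argue in a model of the axioms. A colour is recurrent if it
occurs arbitrarily late. By `Σ⁰₂` induction there is a least code, in Gödel's coding by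
divisibility, of a set containing all colours that occur from some point `b` on; a colour in it that
is not recurrent could be removed, giving a smaller code, so the set consists of recurrent colours.

Let `p` be a `⪯`-minimal colour in this set. If `b < i < j` and `C(i, j) = p`, then `C(i, k) = p`
for all `k > j`, because `C(i, k) ⪯ C(i, j)` again lies in the set. Since `p` is recurrent, one can
greedily select an unbounded set of pairs `i < j` of colour `p`, with `b < i`, each lying entirely
before or after every other one. Their first components form a homogeneous set: for `i < i'` among
them, the partner `j` of `i` satisfies `j < i'`, hence `C(i, i') = p`. -/

namespace SOA

open NTerm Fml

/-! ### Substitution and provability -/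

namespace NTerm

theorem subst_subst (t : NTerm) (σ σ' : ℕ → NTerm) :
    (t.subst σ).subst σ' = t.subst fun n => (σ n).subst σ' := by
  induction t <;> simp_all [subst]

theorem subst_var (t : NTerm) : t.subst var = t := by
  induction t <;> simp_all [subst]

/-- A strict upper bound for the indices of the variables of a term. -/
def bound : NTerm → ℕ
  | var n => n + 1
  | zero => 0
  | one => 0
  | add t u => max t.bound u.bound
  | mul t u => max t.bound u.bound

theorem subst_congr {σ σ' : ℕ → NTerm} (t : NTerm) (h : ∀ n < t.bound, σ n = σ' n) :
    t.subst σ = t.subst σ' := by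
  induction t <;> simp_all [subst, bound]

end NTerm

/-- The substitution `σ` of number terms, as it acts under a number quantifier. -/
def liftN (σ : ℕ → NTerm) : ℕ → NTerm := scons (var 0) fun n => (σ n).shift

/-- The renaming `τ` of set variables, as it acts under a set quantifier. -/
def liftS (τ : ℕ → ℕ) : ℕ → ℕ := scons 0 fun n => τ n + 1

theorem liftN_var : liftN var = var := by
  funext n; cases n <;> rfl

theorem liftS_id : liftS id = id := by
  funext n; cases n <;> rfl

theorem liftN_comp (σ σ' : ℕ → NTerm) :
    (fun n => (liftN σ n).subst (liftN σ')) = liftN fun n => (σ n).subst σ' := by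
  funext n
  cases n with
  | zero => rfl
  | succ n => simp only [liftN, scons, shift, NTerm.subst_subst, NTerm.subst]

theorem liftS_comp (τ τ' : ℕ → ℕ) : liftS τ' ∘ liftS τ = liftS (τ' ∘ τ) := by
  funext n; cases n <;> rfl

namespace Fml

theorem subst_allN (σ : ℕ → NTerm) (τ : ℕ → ℕ) (φ : Fml) :
    (allN φ).subst σ τ = allN (φ.subst (liftN σ) τ) := rfl

theorem subst_allS (σ : ℕ → NTerm) (τ : ℕ → ℕ) (φ : Fml) :
    (allS φ).subst σ τ = allS (φ.subst σ (liftS τ)) := rfl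

theorem subst_subst (φ : Fml) : ∀ (σ σ' : ℕ → NTerm) (τ τ' : ℕ → ℕ),
    (φ.subst σ τ).subst σ' τ' = φ.subst (fun n => (σ n).subst σ') (τ' ∘ τ) := by
  induction φ with
  | allN φ ih => intros; simp only [subst_allN, ih, liftN_comp]
  | allS φ ih => intros; simp only [subst_allS, ih, liftS_comp]
  | _ => simp_all [subst, NTerm.subst_subst]

theorem subst_var_id (φ : Fml) : φ.subst var id = φ := by
  induction φ with
  | allN φ ih => rw [subst_allN, liftN_var, ih]
  | allS φ ih => rw [subst_allS, liftS_id, ih]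
  | _ => simp_all [subst, NTerm.subst_var]

/-- A strict upper bound for the indices of the free number variables of a formula. -/
def boundN : Fml → ℕ
  | eq t u => max t.bound u.bound
  | le t u => max t.bound u.bound
  | mem t _ => t.bound
  | fal => 0
  | imp φ ψ => max φ.boundN ψ.boundN
  | allN φ => φ.boundN
  | allS φ => φ.boundN

/-- A strict upper bound for the indices of the free set variables of a formula. -/
def boundS : Fml → ℕ
  | eq _ _ => 0
  | le _ _ => 0
  | mem _ X => X + 1
  | fal => 0
  | imp φ ψ => max φ.boundS ψ.boundS
  | allN φ => φ.boundS
  | allS φ => φ.boundS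

theorem subst_congr (φ : Fml) : ∀ {σ σ' : ℕ → NTerm} {τ τ' : ℕ → ℕ},
    (∀ n < φ.boundN, σ n = σ' n) → (∀ n < φ.boundS, τ n = τ' n) →
    φ.subst σ τ = φ.subst σ' τ' := by
  induction φ with
  | allN φ ih =>
    intro σ σ' τ τ' hN hS
    rw [subst_allN, subst_allN, ih (fun n hn => ?_) hS]
    cases n with
    | zero => rfl
    | succ n => simp only [liftN, scons, hN n (Nat.lt_of_succ_lt hn)]
  | allS φ ih =>
    intro σ σ' τ τ' hN hS
    rw [subst_allS, subst_allS, ih hN (fun n hn => ?_)]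
    cases n with
    | zero => rfl
    | succ n => simp only [liftS, scons, hS n (Nat.lt_of_succ_lt hn)]
  | imp φ ψ ihφ ihψ =>
    intro σ σ' τ τ' hN hS
    simp only [boundN, boundS, lt_max_iff] at hN hS
    rw [subst, subst, ihφ (fun n hn => hN n (.inl hn)) fun n hn => hS n (.inl hn),
      ihψ (fun n hn => hN n (.inr hn)) fun n hn => hS n (.inr hn)]
  | mem t X =>
    intro σ σ' τ τ' hN hS
    rw [subst, subst, t.subst_congr hN, hS X (Nat.lt_succ_self X)]
  | fal => intros; rfl
  | _ t u =>
    intro σ σ' τ τ' hN _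
    simp only [boundN, lt_max_iff] at hN
    rw [subst, subst, t.subst_congr fun n hn => hN n (.inl hn),
      u.subst_congr fun n hn => hN n (.inr hn)]

theorem subst_instN (φ : Fml) (t : NTerm) (σ : ℕ → NTerm) (τ : ℕ → ℕ) :
    (φ.instN t).subst σ τ = φ.subst (scons (t.subst σ) σ) τ := by
  rw [instN, subst_subst]
  congr 1
  funext n
  cases n <;> rfl

theorem subst_instS (φ : Fml) (k : ℕ) (σ : ℕ → NTerm) (τ : ℕ → ℕ) :
    (φ.instS k).subst σ τ = φ.subst σ (scons (τ k) τ) := by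
  rw [instS, subst_subst]
  congr 1
  funext n
  cases n <;> rfl

theorem instN_subst_liftN (φ : Fml) (t : NTerm) (σ : ℕ → NTerm) (τ : ℕ → ℕ) :
    (φ.subst (liftN σ) τ).instN t = φ.subst (scons t σ) τ := by
  rw [instN, subst_subst]
  congr 1
  funext n
  cases n with
  | zero => rfl
  | succ n => simp only [liftN, scons, shift, NTerm.subst_subst, NTerm.subst, NTerm.subst_var]

theorem instS_subst_liftS (φ : Fml) (k : ℕ) (σ : ℕ → NTerm) (τ : ℕ → ℕ) :
    (φ.subst σ (liftS τ)).instS k = φ.subst σ (scons k τ) := by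
  rw [instS, subst_subst]
  congr 1
  · funext n
    rw [NTerm.subst_var]
  · funext n
    cases n <;> rfl

theorem subst_shiftN (φ : Fml) (σ : ℕ → NTerm) (τ : ℕ → ℕ) :
    φ.shiftN.subst (liftN σ) τ = (φ.subst σ τ).shiftN := by
  rw [shiftN, shiftN, subst_subst, subst_subst]
  rfl

theorem subst_shiftS (φ : Fml) (σ : ℕ → NTerm) (τ : ℕ → ℕ) :
    φ.shiftS.subst σ (liftS τ) = (φ.subst σ τ).shiftS := by
  rw [shiftS, shiftS, subst_subst, subst_subst]
  congr 1
  funext n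
  rw [NTerm.subst_var]
  rfl

end Fml

section Prepend

variable {α : Type}

/-- The sequence `f` with the elements of the list `l` prepended, in order. -/
def prepend (l : List α) (f : ℕ → α) : ℕ → α := l.foldr scons f

theorem prepend_add_length (l : List α) (f : ℕ → α) (n : ℕ) :
    prepend l f (n + l.length) = f n := by
  induction l with
  | nil => rfl
  | cons _ _ ih => exact ih

theorem prepend_map_range (f g : ℕ → α) {m n : ℕ} (h : n < m) :
    prepend ((List.range m).map g) f n = g n := by
  induction m generalizing g n with
  | zero => omega
  | succ m ih =>
    rw [List.range_succ_eq_map, List.map_cons, List.map_map]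
    cases n with
    | zero => rfl
    | succ n => exact ih (g ∘ Nat.succ) (by omega)

end Prepend

namespace Prf

variable {T : Set Fml} {Γ Δ : List Fml} {φ : Fml}

theorem weaken (h : Prf T Γ φ) (hΔ : Γ ⊆ Δ) : Prf T Δ φ := by
  induction h generalizing Δ with
  | ax h => exact ax h
  | hyp h => exact hyp (hΔ h)
  | impI _ ih => exact impI (ih (List.cons_subset_cons _ hΔ))
  | impE _ _ ih₁ ih₂ => exact impE (ih₁ hΔ) (ih₂ hΔ)
  | raa _ ih => exact raa (ih (List.cons_subset_cons _ hΔ))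
  | allNI _ ih => exact allNI (ih (List.map_subset _ hΔ))
  | allNE t _ ih => exact allNE t (ih hΔ)
  | allSI _ ih => exact allSI (ih (List.map_subset _ hΔ))
  | allSE k _ ih => exact allSE k (ih hΔ)
  | eqRefl t => exact eqRefl t
  | eqSubst φ _ _ ih₁ ih₂ => exact eqSubst φ (ih₁ hΔ) (ih₂ hΔ)

theorem subst_prepend_var (l : List NTerm) (h : Prf T [] φ) :
    Prf T [] (φ.subst (prepend l var) id) := by
  induction l generalizing φ with
  | nil => rwa [prepend, List.foldr_nil, subst_var_id]
  | cons t l ih =>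
    have := ih (allNE (t.subst fun n => var (n + l.length)) (allNI (Γ := []) h))
    rw [subst_instN, NTerm.subst_subst] at this
    simp only [NTerm.subst, prepend_add_length, NTerm.subst_var] at this
    exact this

theorem subst_prepend_id (l : List ℕ) (h : Prf T [] φ) :
    Prf T [] (φ.subst var (prepend l id)) := by
  induction l generalizing φ with
  | nil => rwa [prepend, List.foldr_nil, subst_var_id]
  | cons k l ih =>
    have := ih (allSE (k + l.length) (allSI (Γ := []) h))
    rwa [subst_instS, prepend_add_length] at this

theorem subst_nil (h : Prf T [] φ) (σ : ℕ → NTerm) (τ : ℕ → ℕ) : Prf T [] (φ.subst σ τ) := by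
  have hτ : Prf T [] (φ.subst var τ) := by
    have := subst_prepend_id ((List.range φ.boundS).map τ) h
    rwa [φ.subst_congr (fun _ _ => rfl) fun n hn => prepend_map_range id τ hn] at this
  have hσ := subst_prepend_var ((List.range (φ.subst var τ).boundN).map σ) hτ
  rwa [Fml.subst_congr _ (fun n hn => prepend_map_range var σ hn) fun _ _ => rfl,
    Fml.subst_subst] at hσ

theorem subst (h : Prf T Γ φ) : ∀ (σ : ℕ → NTerm) (τ : ℕ → ℕ),
    Prf T (Γ.map (Fml.subst σ τ)) (φ.subst σ τ) := by
  induction h with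
  | ax h => exact fun σ τ => (subst_nil (ax h) σ τ).weaken (List.nil_subset _)
  | hyp h => exact fun σ τ => hyp (List.mem_map_of_mem h)
  | impI _ ih => exact fun σ τ => impI (ih σ τ)
  | impE _ _ ih₁ ih₂ => exact fun σ τ => impE (ih₁ σ τ) (ih₂ σ τ)
  | raa _ ih => exact fun σ τ => raa (ih σ τ)
  | allNI _ ih =>
    intro σ τ
    refine allNI ?_
    have := ih (liftN σ) τ
    simp only [List.map_map, Function.comp_def, subst_shiftN] at this ⊢
    exact this
  | allNE t _ ih =>
    intro σ τ
    rw [subst_instN, ← instN_subst_liftN]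
    exact allNE _ (ih σ τ)
  | allSI _ ih =>
    intro σ τ
    refine allSI ?_
    have := ih σ (liftS τ)
    simp only [List.map_map, Function.comp_def, subst_shiftS] at this ⊢
    exact this
  | allSE k _ ih =>
    intro σ τ
    rw [subst_instS, ← instS_subst_liftS]
    exact allSE _ (ih σ τ)
  | eqRefl t => exact fun σ τ => eqRefl _
  | eqSubst φ _ _ ih₁ ih₂ =>
    intro σ τ
    rw [subst_instN, ← instN_subst_liftN]
    refine eqSubst _ (ih₁ σ τ) ?_
    rw [instN_subst_liftN, ← subst_instN]
    exact ih₂ σ τ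

theorem allNI_of_fresh {k : ℕ} (hΓ : ∀ ψ ∈ Γ, ψ.boundN ≤ k) (hφ : φ.boundN ≤ k)
    (h : Prf T Γ (φ.instN (var k))) : Prf T Γ (allN φ) := by
  let σ : ℕ → NTerm := fun n => if n < k then var (n + 1) else var 0
  have map_subst : Γ.map (Fml.subst σ id) = Γ.map shiftN :=
    List.map_congr_left fun ψ hψ =>
      ψ.subst_congr (fun _ hn => if_pos (hn.trans_le (hΓ ψ hψ))) fun _ _ => rfl
  have subst_φ : (φ.instN (var k)).subst σ id = φ := by
    refine (φ.subst_instN _ σ id).trans (.trans (φ.subst_congr (fun n hn => ?_) fun _ _ => rfl)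
      φ.subst_var_id)
    cases n with
    | zero => exact if_neg (lt_irrefl k)
    | succ n => exact if_pos (by omega)
  exact allNI (map_subst ▸ subst_φ ▸ h.subst σ id)

theorem allSI_of_fresh {k : ℕ} (hΓ : ∀ ψ ∈ Γ, ψ.boundS ≤ k) (hφ : φ.boundS ≤ k)
    (h : Prf T Γ (φ.instS k)) : Prf T Γ (allS φ) := by
  let τ : ℕ → ℕ := fun n => if n < k then n + 1 else 0
  have map_subst : Γ.map (Fml.subst var τ) = Γ.map shiftS :=
    List.map_congr_left fun ψ hψ =>
      ψ.subst_congr (fun _ _ => rfl) fun _ hn => if_pos (hn.trans_le (hΓ ψ hψ))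
  have subst_φ : (φ.instS k).subst var τ = φ := by
    refine (φ.subst_instS k var τ).trans (.trans (φ.subst_congr (fun _ _ => rfl) fun n hn => ?_)
      φ.subst_var_id)
    cases n with
    | zero => exact if_neg (lt_irrefl k)
    | succ n => exact if_pos (by omega)
  exact allSI (map_subst ▸ subst_φ ▸ h.subst var τ)

end Prf

section Semantics

variable {N S : Type} [Zero N] [One N] [Add N] [Mul N]

/-- The value of a term under an assignment of its variables. -/
def NTerm.eval (v : ℕ → N) : NTerm → N
  | var n => v n
  | zero => 0
  | one => 1
  | add t u => t.eval v + u.eval v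
  | mul t u => t.eval v * u.eval v

theorem NTerm.eval_subst (v : ℕ → N) (σ : ℕ → NTerm) (t : NTerm) :
    (t.subst σ).eval v = t.eval fun n => (σ n).eval v := by
  induction t <;> simp_all [NTerm.subst, NTerm.eval]

theorem NTerm.eval_shift (v : ℕ → N) (x : N) (t : NTerm) :
    t.shift.eval (scons x v) = t.eval v :=
  t.eval_subst _ _

variable [LE N]

/-- Tarskian satisfaction in the structure with number sort `N`, set sort `S` and membership
relation `E`, under the assignments `v` and `s` of the number and set variables. -/
def Fml.Sat (E : N → S → Prop) : (ℕ → N) → (ℕ → S) → Fml → Prop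
  | v, _, eq t u => t.eval v = u.eval v
  | v, _, le t u => t.eval v ≤ u.eval v
  | v, s, mem t X => E (t.eval v) (s X)
  | _, _, fal => False
  | v, s, imp φ ψ => Sat E v s φ → Sat E v s ψ
  | v, s, allN φ => ∀ x, Sat E (scons x v) s φ
  | v, s, allS φ => ∀ X, Sat E v (scons X s) φ

theorem Fml.sat_subst (E : N → S → Prop) (φ : Fml) : ∀ (v : ℕ → N) (s : ℕ → S)
    (σ : ℕ → NTerm) (τ : ℕ → ℕ),
    (φ.subst σ τ).Sat E v s ↔ φ.Sat E (fun n => (σ n).eval v) (s ∘ τ) := by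
  induction φ with
  | allN φ ih =>
    intro v s σ τ
    refine forall_congr' fun x => ?_
    rw [ih]
    refine iff_of_eq (congrArg (fun w => φ.Sat E w (s ∘ τ)) (funext fun n => ?_))
    cases n with
    | zero => rfl
    | succ n => exact NTerm.eval_shift v x (σ n)
  | allS φ ih =>
    intro v s σ τ
    refine forall_congr' fun X => ?_
    rw [ih]
    refine iff_of_eq (congrArg (fun s => φ.Sat E _ s) (funext fun n => ?_))
    cases n <;> rfl
  | _ => simp_all [Fml.subst, Fml.Sat, NTerm.eval_subst]

/-- The structure with membership relation `E` satisfies the universal closures of the axioms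
in `T`. -/
def Models (T : Set Fml) (E : N → S → Prop) : Prop := ∀ φ ∈ T, ∀ v s, φ.Sat E v s

theorem Models.mono {T T' : Set Fml} {E : N → S → Prop} (h : Models T' E) (hT : T ⊆ T') :
    Models T E :=
  fun φ hφ => h φ (hT hφ)

end Semantics

/-- Semantic consequence. The set sort of a structure is nonempty, as the number sort is. -/
def Entails (T : Set Fml) (φ : Fml) : Prop :=
  ∀ (N S : Type) [Nonempty S] [Zero N] [One N] [Add N] [Mul N] [LE N] (E : N → S → Prop),
    Models T E → ∀ v s, φ.Sat E v s

/-! ### Completeness -/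

/-- An injective coding of terms by numbers. -/
def NTerm.code : NTerm → ℕ
  | var n => Nat.pair 0 n
  | zero => Nat.pair 1 0
  | one => Nat.pair 2 0
  | add t u => Nat.pair 3 (Nat.pair t.code u.code)
  | mul t u => Nat.pair 4 (Nat.pair t.code u.code)

theorem NTerm.code_injective : Function.Injective NTerm.code := by
  intro t
  induction t <;> intro u h <;> cases u <;> simp_all [NTerm.code, Nat.pair_eq_pair] <;> grind

/-- An injective coding of formulas by numbers. -/
def Fml.code : Fml → ℕ
  | eq t u => Nat.pair 0 (Nat.pair t.code u.code)
  | le t u => Nat.pair 1 (Nat.pair t.code u.code)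
  | mem t X => Nat.pair 2 (Nat.pair t.code X)
  | fal => Nat.pair 3 0
  | imp φ ψ => Nat.pair 4 (Nat.pair φ.code ψ.code)
  | allN φ => Nat.pair 5 φ.code
  | allS φ => Nat.pair 6 φ.code

theorem Fml.code_injective : Function.Injective Fml.code := by
  intro φ
  induction φ <;> intro ψ h <;> cases ψ <;>
    simp_all [Fml.code, Nat.pair_eq_pair, NTerm.code_injective.eq_iff] <;> grind

instance : Countable Fml := Fml.code_injective.countable

instance : Nonempty Fml := ⟨fal⟩

/-- If `φ` is universally quantified, then the negation of an instance of `φ` by a variable belongs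
to `G`. -/
def Fml.HasCounterexample (G : Set Fml) : Fml → Prop
  | allN φ => ∃ k, neg (φ.instN (var k)) ∈ G
  | allS φ => ∃ k, neg (φ.instS k) ∈ G
  | _ => True

/-- `G` contains `φ`, or it contains the negation of `φ` and, if `φ` is universally quantified,
that of an instance of `φ`. -/
def Fml.DecidedBy (G : Set Fml) (φ : Fml) : Prop :=
  φ ∈ G ∨ neg φ ∈ G ∧ φ.HasCounterexample G

theorem Fml.HasCounterexample.mono {G G' : Set Fml} {φ : Fml} (h : φ.HasCounterexample G)
    (hG : G ⊆ G') : φ.HasCounterexample G' := by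
  cases φ with
  | allN φ => exact Exists.imp (fun _ hk => hG hk) h
  | allS φ => exact Exists.imp (fun _ hk => hG hk) h
  | _ => trivial

theorem Fml.DecidedBy.mono {G G' : Set Fml} {φ : Fml} (h : φ.DecidedBy G) (hG : G ⊆ G') :
    φ.DecidedBy G' :=
  h.imp (fun hφ => hG hφ) fun ⟨hφ, hc⟩ => ⟨hG hφ, hc.mono hG⟩

/-- The context `Γ` is consistent over the theory `T`. -/
def Consistent (T : Set Fml) (Γ : List Fml) : Prop := ¬ Prf T Γ fal

theorem Prf.exfalso {T : Set Fml} {Γ : List Fml} (φ : Fml) (h : Prf T Γ fal) : Prf T Γ φ :=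
  raa (h.weaken (List.subset_cons_self _ _))

theorem exists_forall_mem_le (f : Fml → ℕ) (Γ : List Fml) : ∃ k, ∀ φ ∈ Γ, f φ ≤ k :=
  let ⟨k, hk⟩ := (Γ.finite_toSet.image f).bddAbove
  ⟨k, fun _ hφ => hk (Set.mem_image_of_mem f hφ)⟩

namespace Consistent

variable {T : Set Fml} {Γ : List Fml}

theorem cons_or_cons_neg (hΓ : Consistent T Γ) (φ : Fml) :
    Consistent T (φ :: Γ) ∨ Consistent T (neg φ :: Γ) := by
  by_contra! h
  exact hΓ (.impE (.impI (not_not.1 h.2)) (.impI (not_not.1 h.1)))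

theorem exists_cons_neg_instN {φ : Fml} (hΓ : Consistent T (neg (allN φ) :: Γ)) :
    ∃ k, Consistent T (neg (φ.instN (var k)) :: neg (allN φ) :: Γ) := by
  obtain ⟨k, hk⟩ := exists_forall_mem_le boundN (φ :: neg (allN φ) :: Γ)
  rw [List.forall_mem_cons] at hk
  exact ⟨k, fun h => hΓ (.impE (.hyp List.mem_cons_self) (.allNI_of_fresh hk.2 hk.1 (.raa h)))⟩

theorem exists_cons_neg_instS {φ : Fml} (hΓ : Consistent T (neg (allS φ) :: Γ)) :
    ∃ k, Consistent T (neg (φ.instS k) :: neg (allS φ) :: Γ) := by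
  obtain ⟨k, hk⟩ := exists_forall_mem_le boundS (φ :: neg (allS φ) :: Γ)
  rw [List.forall_mem_cons] at hk
  exact ⟨k, fun h => hΓ (.impE (.hyp List.mem_cons_self) (.allSI_of_fresh hk.2 hk.1 (.raa h)))⟩

theorem exists_decidedBy (hΓ : Consistent T Γ) (φ : Fml) :
    ∃ Δ, Consistent T Δ ∧ Γ ⊆ Δ ∧ φ.DecidedBy {ψ | ψ ∈ Δ} := by
  rcases hΓ.cons_or_cons_neg φ with hφ | hφ
  · exact ⟨_, hφ, List.subset_cons_self _ _, .inl List.mem_cons_self⟩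
  have subset (ψ : Fml) : Γ ⊆ ψ :: neg φ :: Γ :=
    List.subset_cons_of_subset _ (List.subset_cons_self _ _)
  have neg_mem (ψ : Fml) : neg φ ∈ ψ :: neg φ :: Γ := List.mem_cons_of_mem _ List.mem_cons_self
  cases φ with
  | allN φ =>
    obtain ⟨k, hk⟩ := hφ.exists_cons_neg_instN
    exact ⟨_, hk, subset _, .inr ⟨neg_mem _, k, List.mem_cons_self⟩⟩
  | allS φ =>
    obtain ⟨k, hk⟩ := hφ.exists_cons_neg_instS
    exact ⟨_, hk, subset _, .inr ⟨neg_mem _, k, List.mem_cons_self⟩⟩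
  | _ => exact ⟨_, hφ, List.subset_cons_self _ _, .inr ⟨List.mem_cons_self, trivial⟩⟩

theorem exists_chain (hΓ : Consistent T Γ) :
    ∃ Δ : ℕ → List Fml, Δ 0 = Γ ∧ (∀ n, Consistent T (Δ n)) ∧ (∀ n, Δ n ⊆ Δ (n + 1)) ∧
      ∀ φ : Fml, ∃ n, φ.DecidedBy {ψ | ψ ∈ Δ n} := by
  obtain ⟨enum, enum_surjective⟩ := exists_surjective_nat Fml
  choose ext ext_consistent subset_ext ext_decides using
    fun (Γ : {Γ // Consistent T Γ}) φ => Γ.2.exists_decidedBy φ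
  let Δ : ℕ → {Γ // Consistent T Γ} :=
    fun n => Nat.rec ⟨Γ, hΓ⟩ (fun n Θ => ⟨ext Θ (enum n), ext_consistent Θ (enum n)⟩) n
  refine ⟨fun n => (Δ n).1, rfl, fun n => (Δ n).2, fun n => subset_ext (Δ n) (enum n), fun φ => ?_⟩
  obtain ⟨n, rfl⟩ := enum_surjective φ
  exact ⟨n + 1, ext_decides (Δ n) (enum n)⟩

end Consistent

/-- `G` is a complete theory containing `T` in which every refuted universal formula has a
counterexample, as in Henkin's construction. -/
structure IsHenkin (T G : Set Fml) : Prop where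
  mem_of_prf : ∀ {Γ : List Fml} {φ : Fml}, Prf T Γ φ → (∀ ψ ∈ Γ, ψ ∈ G) → φ ∈ G
  fal_notMem : fal ∉ G
  decidedBy : ∀ φ : Fml, φ.DecidedBy G

open Filter in
theorem Consistent.exists_isHenkin {T : Set Fml} {Γ : List Fml} (hΓ : Consistent T Γ) :
    ∃ G, IsHenkin T G ∧ ∀ φ ∈ Γ, φ ∈ G := by
  obtain ⟨Δ, rfl, consistent, subset_succ, decided⟩ := hΓ.exists_chain
  let G : Set Fml := {φ | ∀ᶠ n in atTop, φ ∈ Δ n}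
  have subset_G (n : ℕ) : {φ | φ ∈ Δ n} ⊆ G := fun φ hφ =>
    eventually_atTop.2 ⟨n, fun m hm => Nat.le_induction hφ (fun k _ h => subset_succ k h) m hm⟩
  have decidedBy_G (φ : Fml) : φ.DecidedBy G :=
    let ⟨n, hn⟩ := decided φ
    hn.mono (subset_G n)
  refine ⟨G, ⟨fun {Θ φ} h hΘ => ?_, fun h => ?_, decidedBy_G⟩, subset_G 0⟩
  · refine (decidedBy_G φ).resolve_right fun ⟨hneg, _⟩ => ?_
    have hΘ' : ∀ᶠ n in atTop, ∀ ψ ∈ Θ, ψ ∈ Δ n := (eventually_all_finite Θ.finite_toSet).2 hΘ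
    obtain ⟨n, hn, hnΘ⟩ := (hneg.and hΘ').exists
    exact consistent n (.impE (.hyp hn) (h.weaken hnΘ))
  · obtain ⟨n, hn⟩ := h.exists
    exact consistent n (.hyp hn)

namespace IsHenkin

variable {T G : Set Fml} (hG : IsHenkin T G)

include hG

theorem mem_of_prf_nil {φ : Fml} (h : Prf T [] φ) : φ ∈ G :=
  hG.mem_of_prf h fun _ hψ => absurd hψ List.not_mem_nil

theorem imp_mem_iff {φ ψ : Fml} : imp φ ψ ∈ G ↔ (φ ∈ G → ψ ∈ G) := by
  constructor
  · intro hφψ hφ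
    exact hG.mem_of_prf (Γ := [imp φ ψ, φ]) (.impE (φ := φ) (.hyp (by simp)) (.hyp (by simp)))
      (by simp [hφψ, hφ])
  · intro h
    rcases hG.decidedBy φ with hφ | ⟨hφ, -⟩
    · exact hG.mem_of_prf (Γ := [ψ]) (.impI (.hyp (by simp))) (by simp [h hφ])
    · refine hG.mem_of_prf (Γ := [neg φ]) (.impI (.exfalso _ ?_)) (by simp [hφ])
      exact .impE (φ := φ) (.hyp (by simp [neg])) (.hyp (by simp))

theorem notMem_of_neg_mem {φ : Fml} (h : neg φ ∈ G) : φ ∉ G :=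
  fun hφ => hG.fal_notMem (hG.imp_mem_iff.1 h hφ)

theorem allN_mem_iff {φ : Fml} : allN φ ∈ G ↔ ∀ t, φ.instN t ∈ G := by
  constructor
  · intro h t
    exact hG.mem_of_prf (Γ := [allN φ]) (.allNE t (.hyp (by simp))) (by simp [h])
  · intro h
    refine (hG.decidedBy (allN φ)).resolve_right fun ⟨_, k, hk⟩ => ?_
    exact hG.notMem_of_neg_mem hk (h (var k))

theorem allS_mem_iff {φ : Fml} : allS φ ∈ G ↔ ∀ k, φ.instS k ∈ G := by
  constructor
  · intro h k
    exact hG.mem_of_prf (Γ := [allS φ]) (.allSE k (.hyp (by simp))) (by simp [h])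
  · intro h
    refine (hG.decidedBy (allS φ)).resolve_right fun ⟨_, k, hk⟩ => ?_
    exact hG.notMem_of_neg_mem hk (h k)

theorem subst_scons_mem {t u : NTerm} (htu : eq t u ∈ G) (φ : Fml) (σ : ℕ → NTerm) (τ : ℕ → ℕ)
    (h : φ.subst (scons t σ) τ ∈ G) : φ.subst (scons u σ) τ ∈ G := by
  rw [← instN_subst_liftN] at h ⊢
  exact hG.mem_of_prf (Γ := [eq t u, (φ.subst (liftN σ) τ).instN t])
    (.eqSubst (t := t) _ (.hyp (by simp)) (.hyp (by simp))) (by simp [htu, h])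

theorem eq_refl (t : NTerm) : eq t t ∈ G := hG.mem_of_prf_nil (.eqRefl t)

theorem eq_symm {t u : NTerm} (h : eq t u ∈ G) : eq u t ∈ G :=
  hG.subst_scons_mem h (eq (var 0) (var 1)) (scons t var) id (hG.eq_refl t)

theorem eq_trans {t u w : NTerm} (htu : eq t u ∈ G) (huw : eq u w ∈ G) : eq t w ∈ G :=
  hG.subst_scons_mem huw (eq (var 1) (var 0)) (scons t var) id htu

theorem add_congr {t u t' u' : NTerm} (h : eq t u ∈ G) (h' : eq t' u' ∈ G) :
    eq (add t t') (add u u') ∈ G :=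
  hG.subst_scons_mem h (eq (add (var 1) (var 2)) (add (var 0) (var 3)))
    (scons t (scons t' (scons u' var))) id <|
  hG.subst_scons_mem h' (eq (add (var 1) (var 2)) (add (var 1) (var 0)))
    (scons t (scons t' var)) id (hG.eq_refl _)

theorem mul_congr {t u t' u' : NTerm} (h : eq t u ∈ G) (h' : eq t' u' ∈ G) :
    eq (mul t t') (mul u u') ∈ G :=
  hG.subst_scons_mem h (eq (mul (var 1) (var 2)) (mul (var 0) (var 3)))
    (scons t (scons t' (scons u' var))) id <|
  hG.subst_scons_mem h' (eq (mul (var 1) (var 2)) (mul (var 1) (var 0)))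
    (scons t (scons t' var)) id (hG.eq_refl _)

theorem le_congr {t u t' u' : NTerm} (h : eq t u ∈ G) (h' : eq t' u' ∈ G)
    (hle : le t t' ∈ G) : le u u' ∈ G :=
  hG.subst_scons_mem h (le (var 0) (var 1)) (scons u' var) id <|
  hG.subst_scons_mem h' (le (var 1) (var 0)) (scons t var) id hle

theorem mem_congr {t u : NTerm} (h : eq t u ∈ G) {X : ℕ} (ht : mem t X ∈ G) : mem u X ∈ G :=
  hG.subst_scons_mem h (mem (var 0) X) var id ht

/-- Equality of terms, as judged by a Henkin theory. -/
def setoid : Setoid NTerm where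
  r t u := eq t u ∈ G
  iseqv := ⟨hG.eq_refl, hG.eq_symm, hG.eq_trans⟩

/-- The number sort of the term model of a Henkin theory; its set sort is the type `ℕ` of set
variables. -/
def TermModel : Type := Quotient hG.setoid

namespace TermModel

omit hG

variable {hG : IsHenkin T G}

/-- The element of the term model named by a term. -/
def mk (t : NTerm) : hG.TermModel := Quotient.mk hG.setoid t

theorem mk_surjective : Function.Surjective (mk : NTerm → hG.TermModel) := Quotient.mk_surjective

theorem mk_eq_mk {t u : NTerm} : (mk t : hG.TermModel) = mk u ↔ eq t u ∈ G := Quotient.eq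

instance : Zero hG.TermModel := ⟨mk .zero⟩

instance : One hG.TermModel := ⟨mk .one⟩

instance : Add hG.TermModel := ⟨Quotient.map₂ .add fun _ _ h _ _ h' => hG.add_congr h h'⟩

instance : Mul hG.TermModel := ⟨Quotient.map₂ .mul fun _ _ h _ _ h' => hG.mul_congr h h'⟩

instance : LE hG.TermModel where
  le := Quotient.lift₂ (fun t u => le t u ∈ G) fun _ _ _ _ h h' =>
    propext ⟨hG.le_congr h h', hG.le_congr (hG.eq_symm h) (hG.eq_symm h')⟩

/-- The membership relation of the term model. -/
def Mem (x : hG.TermModel) (X : ℕ) : Prop :=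
  Quotient.lift (fun t => mem t X ∈ G)
    (fun _ _ h => propext ⟨hG.mem_congr h, hG.mem_congr (hG.eq_symm h)⟩) x

theorem eval_mk (σ : ℕ → NTerm) (t : NTerm) :
    t.eval (fun n => (mk (σ n) : hG.TermModel)) = mk (t.subst σ) := by
  induction t with
  | add t u iht ihu => rw [NTerm.eval, iht, ihu]; rfl
  | mul t u iht ihu => rw [NTerm.eval, iht, ihu]; rfl
  | _ => rfl

theorem sat_mk_iff (φ : Fml) : ∀ (σ : ℕ → NTerm) (τ : ℕ → ℕ),
    φ.Sat (Mem (hG := hG)) (fun n => mk (σ n)) τ ↔ φ.subst σ τ ∈ G := by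
  induction φ with
  | eq t u => intro σ τ; rw [Fml.Sat, eval_mk, eval_mk]; exact mk_eq_mk
  | le t u => intro σ τ; rw [Fml.Sat, eval_mk, eval_mk]; rfl
  | mem t X => intro σ τ; rw [Fml.Sat, eval_mk]; rfl
  | fal => intro σ τ; exact iff_of_false id hG.fal_notMem
  | imp φ ψ ihφ ihψ => intro σ τ; rw [Fml.Sat, ihφ, ihψ, Fml.subst, hG.imp_mem_iff]
  | allN φ ih =>
    intro σ τ
    have scons_mk (t : NTerm) :
        scons (mk t : hG.TermModel) (fun n => mk (σ n)) = fun n => mk (scons t σ n) := by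
      funext n; cases n <;> rfl
    simp only [Fml.Sat, subst_allN, hG.allN_mem_iff, mk_surjective.forall, scons_mk, ih,
      instN_subst_liftN]
  | allS φ ih =>
    intro σ τ
    simp only [Fml.Sat, subst_allS, hG.allS_mem_iff, ih, instS_subst_liftS]

theorem models : Models T (Mem (hG := hG)) := by
  intro φ hφ v s
  obtain ⟨σ, rfl⟩ := mk_surjective.comp_left v
  exact (sat_mk_iff φ σ s).2 (hG.mem_of_prf_nil (Prf.subst_nil (.ax hφ) σ s))

end TermModel

end IsHenkin

theorem Entails.proves {T : Set Fml} {φ : Fml} (h : Entails T φ) : Proves T φ := by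
  by_contra hφ
  have consistent : Consistent T [neg φ] := fun hfal => hφ (.raa hfal)
  obtain ⟨G, hG, neg_mem⟩ := consistent.exists_isHenkin
  have hsat := h hG.TermModel ℕ _ IsHenkin.TermModel.models (fun n => .mk (var n)) id
  rw [IsHenkin.TermModel.sat_mk_iff, subst_var_id] at hsat
  exact hG.notMem_of_neg_mem (neg_mem _ List.mem_cons_self) hsat

/-! ### Definability -/

namespace Fml

/-- `∀ x < t, φ`, where `x` does not occur in `t`. -/
def bltN (t : NTerm) (φ : Fml) : Fml := ballN t (imp (lt (var 0) t.shift) φ)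

/-- `t` divides `u`; a quotient is bounded by `u`. -/
def dvd (t u : NTerm) : Fml := bexN u (eq u.shift (mul t.shift (var 0)))

end Fml

attribute [simp] IsDelta0.eq IsDelta0.le IsDelta0.mem IsDelta0.fal IsDelta0.imp IsDelta0.ball
  IsDelta0.bex

namespace IsDelta0

variable {φ ψ : Fml}

@[simp]
theorem neg (h : IsDelta0 φ) : IsDelta0 (Fml.neg φ) := .imp h .fal

@[simp]
theorem and (h : IsDelta0 φ) (h' : IsDelta0 ψ) : IsDelta0 (Fml.and φ ψ) := .neg (.imp h (.neg h'))

@[simp]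
theorem iff (h : IsDelta0 φ) (h' : IsDelta0 ψ) : IsDelta0 (Fml.iff φ ψ) :=
  .and (.imp h h') (.imp h' h)

@[simp]
theorem lt (t u : NTerm) : IsDelta0 (Fml.lt t u) := .and (.le t u) (.neg (.eq t u))

@[simp]
theorem blt (t : NTerm) (h : IsDelta0 φ) : IsDelta0 (bltN t φ) := .ball _ (.imp (.lt _ _) h)

@[simp]
theorem dvd (t u : NTerm) : IsDelta0 (Fml.dvd t u) := .bex _ (.eq _ _)

theorem isSigma_one (h : IsDelta0 φ) : IsSigma 1 φ := .ofPi (.zero _ h)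

end IsDelta0

section Definability

variable {N S : Type} [Zero N] [One N] [Add N] [Mul N]

@[simp]
theorem scons_zero {α : Type} (a : α) (f : ℕ → α) : scons a f 0 = a := rfl

@[simp]
theorem scons_succ {α : Type} (a : α) (f : ℕ → α) (n : ℕ) : scons a f (n + 1) = f n := rfl

attribute [simp] NTerm.eval NTerm.eval_shift

section Sat

variable [LE N] (E : N → S → Prop) (v : ℕ → N) (s : ℕ → S)

attribute [simp] Fml.Sat

@[simp]
theorem sat_neg (φ : Fml) : (neg φ).Sat E v s ↔ ¬ φ.Sat E v s := Iff.rfl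

@[simp]
theorem sat_and (φ ψ : Fml) : (Fml.and φ ψ).Sat E v s ↔ φ.Sat E v s ∧ ψ.Sat E v s := by
  simp [Fml.and]

@[simp]
theorem sat_or (φ ψ : Fml) : (Fml.or φ ψ).Sat E v s ↔ φ.Sat E v s ∨ ψ.Sat E v s := by
  simp [Fml.or, or_iff_not_imp_left]

@[simp]
theorem sat_iff (φ ψ : Fml) : (Fml.iff φ ψ).Sat E v s ↔ (φ.Sat E v s ↔ ψ.Sat E v s) := by
  simp [Fml.iff, iff_def]

@[simp]
theorem sat_exN (φ : Fml) : (exN φ).Sat E v s ↔ ∃ x, φ.Sat E (scons x v) s := by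
  simp [exN]

@[simp]
theorem sat_exS (φ : Fml) : (exS φ).Sat E v s ↔ ∃ X, φ.Sat E v (scons X s) := by
  simp [exS]

@[simp]
theorem sat_ballN (t : NTerm) (φ : Fml) :
    (ballN t φ).Sat E v s ↔ ∀ x ≤ t.eval v, φ.Sat E (scons x v) s := by
  simp [ballN]

@[simp]
theorem sat_bexN (t : NTerm) (φ : Fml) :
    (bexN t φ).Sat E v s ↔ ∃ x ≤ t.eval v, φ.Sat E (scons x v) s := by
  simp [bexN]

end Sat

@[simp]
theorem sat_lt [PartialOrder N] (E : N → S → Prop) (v : ℕ → N) (s : ℕ → S) (t u : NTerm) :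
    (Fml.lt t u).Sat E v s ↔ t.eval v < u.eval v := by
  simp [Fml.lt, lt_iff_le_and_ne]

@[simp]
theorem sat_bltN [PartialOrder N] (E : N → S → Prop) (v : ℕ → N) (s : ℕ → S) (t : NTerm)
    (φ : Fml) : (bltN t φ).Sat E v s ↔ ∀ x < t.eval v, φ.Sat E (scons x v) s := by
  simp only [bltN, sat_ballN, Fml.Sat, sat_lt, NTerm.eval, NTerm.eval_shift, scons_zero]
  exact forall_congr' fun x => ⟨fun h hx => h hx.le hx, fun h _ => h⟩

variable [LE N] {E : N → S → Prop} {n : ℕ}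

/-- The predicate `p` is defined by a `Σ⁰ₙ` formula with parameters. -/
def SigmaDefinable (E : N → S → Prop) (n : ℕ) (p : N → Prop) : Prop :=
  ∃ (φ : Fml) (v : ℕ → N) (s : ℕ → S), IsSigma n φ ∧ ∀ x, φ.Sat E (scons x v) s ↔ p x

/-- Induction for the `Σ⁰ₙ` definable predicates. -/
def SigmaInduction (E : N → S → Prop) (n : ℕ) : Prop :=
  ∀ p, SigmaDefinable E n p → p 0 → (∀ x, p x → p (x + 1)) → ∀ x, p x

/-- The predicate `p` and its negation are defined by `Σ⁰₁` formulas with the same parameters. -/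
def DeltaOneDefinable (E : N → S → Prop) (p : N → Prop) : Prop :=
  ∃ (φ ψ : Fml) (v : ℕ → N) (s : ℕ → S), IsSigma 1 φ ∧ IsSigma 1 ψ ∧
    (∀ x, φ.Sat E (scons x v) s ↔ p x) ∧ ∀ x, ψ.Sat E (scons x v) s ↔ ¬ p x

/-- Comprehension for the `Δ⁰₁` definable predicates. -/
def DeltaOneComprehension (E : N → S → Prop) : Prop :=
  ∀ p, DeltaOneDefinable E p → ∃ X, ∀ x, E x X ↔ p x

theorem Models.sigmaInduction (h : Models (SigmaIND n) E) : SigmaInduction E n := by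
  rintro p ⟨φ, v, s, hφ, hp⟩ zero succ
  have eval_zero : (fun n => (scons NTerm.zero var n).eval v) = scons 0 v := by
    funext n; cases n <;> rfl
  have eval_succ (x : N) :
      (fun n => (scons (add (var 0) one) (fun n => var (n + 1)) n).eval (scons x v)) =
        scons (x + 1) v := by
    funext n; cases n <;> rfl
  have ind := h _ ⟨φ, hφ, rfl⟩ v s
  simp only [indAxiom, Fml.Sat, sat_and, instN, atSucc, sat_subst, eval_zero, eval_succ,
    Function.comp_id, hp] at ind
  exact ind ⟨zero, succ⟩

theorem Models.deltaOneComprehension (h : Models Delta1CA E) : DeltaOneComprehension E := by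
  rintro p ⟨φ, ψ, v, s, hφ, hψ, hp, hp'⟩
  have tail_scons (X : S) : (scons X s ∘ fun n => n + 1) = s := rfl
  have compr := h _ ⟨φ, ψ, hφ, hψ, rfl⟩ v s
  simp only [comprAxiom, Fml.Sat, sat_iff, sat_neg, sat_exS, shiftS, sat_subst, tail_scons,
    NTerm.eval, scons_zero, hp, hp', not_not] at compr
  exact compr fun _ => trivial

theorem IsDelta0.deltaOneDefinable {φ : Fml} (hφ : IsDelta0 φ) (v : ℕ → N) (s : ℕ → S)
    {p : N → Prop} (hp : ∀ x, φ.Sat E (scons x v) s ↔ p x) : DeltaOneDefinable E p :=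
  ⟨φ, Fml.neg φ, v, s, hφ.isSigma_one, hφ.neg.isSigma_one, hp, fun x => not_congr (hp x)⟩

end Definability

/-! ### Arithmetic -/

section Arithmetic

variable {N : Type} [CommSemiring N]

/-- The code of a pair, as in `NTerm.pair`. -/
def pr (a b : N) : N := (a + b) * (a + b) + a

/-- `d` is positive and divisible by all positive numbers up to `a`: then the moduli
`1 + (x + 1) * d`, for `x ≤ a`, are pairwise coprime. -/
def IsMultiple [LE N] (d a : N) : Prop := 1 ≤ d ∧ ∀ k ≤ a, 1 ≤ k → k ∣ d

/-- Gödel's coding of finite sets by divisibility: `x` belongs to the set with code `c, d`. -/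
def CodeMem (x c d : N) : Prop := 1 + (x + 1) * d ∣ c

@[simp]
theorem eval_pair (v : ℕ → N) (t u : NTerm) : (pair t u).eval v = pr (t.eval v) (u.eval v) := rfl

@[simp]
theorem eval_triple (v : ℕ → N) (t u w : NTerm) :
    (triple t u w).eval v = pr (pr (t.eval v) (u.eval v)) (w.eval v) := rfl

variable [LinearOrder N] [CanonicallyOrderedAdd N]

theorem le_pr_left (a b : N) : a ≤ pr a b := le_add_self

variable [IsStrictOrderedRing N]

theorem dvd_of_dvd_add {a b c : N} (h : a ∣ b + c) (hb : a ∣ b) : a ∣ c := by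
  obtain ⟨m, rfl⟩ := hb
  obtain ⟨n, hn⟩ := h
  obtain hmn | hnm := le_total m n
  · obtain ⟨r, rfl⟩ := exists_add_of_le hmn
    exact ⟨r, add_left_cancel (hn.trans (mul_add a m r))⟩
  · have : a * m + c ≤ a * m := hn.trans_le (by gcongr)
    rw [add_le_iff_nonpos_right, nonpos_iff_eq_zero] at this
    exact this ▸ dvd_zero a

theorem dvd_of_dvd_mul_of_dvd {c e k : N} (hk : k ∣ e) (h : 1 + e ∣ c * k) : 1 + e ∣ c := by
  obtain ⟨l, rfl⟩ := hk
  exact dvd_of_dvd_add (b := c * k * l) ⟨c, by ring⟩ (h.mul_right l)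

theorem one_lt_modulus {d : N} (hd : 1 ≤ d) (x : N) : 1 < 1 + (x + 1) * d :=
  lt_add_of_pos_right _ (mul_pos (by positivity) (zero_lt_one.trans_le hd))

variable [SuccAddOrder N]

theorem pr_lt_pr {a b a' b' : N} (h : a + b < a' + b') : pr a b < pr a' b' :=
  have h : a + b + 1 ≤ a' + b' := Order.add_one_le_of_lt h
  calc pr a b < pr a b + (a + b + b + 1) := lt_add_of_pos_right _ (by positivity)
    _ = (a + b + 1) * (a + b + 1) := by rw [pr]; ring
    _ ≤ (a' + b') * (a' + b') := by gcongr
    _ ≤ pr a' b' := le_self_add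

theorem pr_inj {a b a' b' : N} : pr a b = pr a' b' ↔ a = a' ∧ b = b' := by
  refine ⟨fun h => ?_, fun ⟨ha, hb⟩ => ha ▸ hb ▸ rfl⟩
  have hsum : a + b = a' + b' := by
    by_contra hne
    obtain hlt | hlt := lt_or_gt_of_ne hne
    · exact (pr_lt_pr hlt).ne h
    · exact (pr_lt_pr hlt).ne' h
  have ha : a = a' := by rwa [pr, pr, hsum, add_right_inj] at h
  exact ⟨ha, by rwa [ha, add_right_inj] at hsum⟩

theorem le_pr_right (a b : N) : b ≤ pr a b := by
  obtain h | h := eq_or_ne (a + b) 0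
  · exact (le_add_self.trans h.le).trans zero_le
  · calc b ≤ a + b := le_add_self
      _ ≤ (a + b) * (a + b) :=
        le_mul_of_one_le_left' (Order.one_le_iff_pos.2 (pos_iff_ne_zero.2 h))
      _ ≤ pr a b := le_self_add

theorem not_codeMem_one {d : N} (hd : 1 ≤ d) (x : N) : ¬ CodeMem x 1 d := by
  rintro ⟨e, he⟩
  have : e ≠ 0 := by rintro rfl; simp at he
  have hle : 1 + (x + 1) * d ≤ (1 + (x + 1) * d) * e :=
    le_mul_of_one_le_right zero_le (Order.one_le_iff_pos.2 (pos_iff_ne_zero.2 this))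
  exact (one_lt_modulus hd x).not_ge (hle.trans_eq he.symm)

/- With `k` the distance of `x` and `y`, the modulus of `x` divides `c * k`, a combination of
itself and the modulus of `y`; as `k` divides `d`, it then divides `c`. -/
theorem CodeMem.of_mul {d a x y c : N} (hd : IsMultiple d a) (hx : x ≤ a) (hy : y ≤ a)
    (hxy : x ≠ y) (h : CodeMem x (c * (1 + (y + 1) * d)) d) : CodeMem x c d := by
  suffices ∃ k, 0 < k ∧ k ≤ a ∧ 1 + (x + 1) * d ∣ c * k by
    obtain ⟨k, hk, hka, hdvd⟩ := this
    have hkd : k ∣ d := hd.2 k hka (Order.one_le_iff_pos.2 hk)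
    exact dvd_of_dvd_mul_of_dvd (hkd.mul_left _) hdvd
  obtain hlt | hlt := lt_or_gt_of_ne hxy
  · obtain ⟨k, hk, rfl⟩ := exists_pos_add_of_lt' hlt
    refine ⟨k, hk, le_add_self.trans hy,
      dvd_of_dvd_add (b := c * (1 + (x + k + 1) * d) * (x + 1)) ?_ (Dvd.dvd.mul_right h _)⟩
    exact ⟨c * (x + k + 1), by ring⟩
  · obtain ⟨k, hk, rfl⟩ := exists_pos_add_of_lt' hlt
    refine ⟨k, hk, le_add_self.trans hx,
      dvd_of_dvd_add (b := (1 + (y + k + 1) * d) * (c * (y + 1))) ?_ (dvd_mul_right _ _)⟩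
    have : (1 + (y + k + 1) * d) * (c * (y + 1)) + c * k =
        c * (1 + (y + 1) * d) * (y + k + 1) := by ring
    exact this ▸ Dvd.dvd.mul_right h _

theorem codeMem_mul_iff {d a x y c : N} (hd : IsMultiple d a) (hx : x ≤ a) (hy : y ≤ a) :
    CodeMem x (c * (1 + (y + 1) * d)) d ↔ x = y ∨ CodeMem x c d := by
  refine ⟨fun h => or_iff_not_imp_left.2 fun hxy => h.of_mul hd hx hy hxy, ?_⟩
  rintro (rfl | h)
  · exact dvd_mul_left _ _
  · exact Dvd.dvd.mul_right h _

end Arithmetic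

/-- The formula `CodeMem x c d`. -/
def Fml.codeMem (x c d : NTerm) : Fml := Fml.dvd (add one (mul (add x one) d)) c

@[simp]
theorem IsDelta0.codeMem (x c d : NTerm) : IsDelta0 (Fml.codeMem x c d) := .dvd _ _

section Sat

variable {N S : Type} [CommSemiring N] [LinearOrder N] [CanonicallyOrderedAdd N]
  [IsStrictOrderedRing N] [SuccAddOrder N] (E : N → S → Prop) (v : ℕ → N) (s : ℕ → S)

@[simp]
theorem sat_dvd (t u : NTerm) : (Fml.dvd t u).Sat E v s ↔ t.eval v ∣ u.eval v := by
  simp only [Fml.dvd, sat_bexN, Fml.Sat, NTerm.eval, NTerm.eval_shift, scons_zero]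
  refine ⟨fun ⟨e, _, he⟩ => ⟨e, he⟩, fun ⟨e, he⟩ => ?_⟩
  obtain ht | ht := eq_or_ne (t.eval v) 0
  · exact ⟨0, zero_le, by simp [he, ht]⟩
  · refine ⟨e, he ▸ ?_, he⟩
    exact le_mul_of_one_le_left zero_le (Order.one_le_iff_pos.2 (pos_iff_ne_zero.2 ht))

@[simp]
theorem sat_codeMem (x c d : NTerm) :
    (Fml.codeMem x c d).Sat E v s ↔ CodeMem (x.eval v) (c.eval v) (d.eval v) :=
  sat_dvd E v s _ _

end Sat

/-! ### Consequences of induction and comprehension -/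

section Induction

variable {N S : Type} [CommSemiring N] [LinearOrder N] [CanonicallyOrderedAdd N]
  [IsStrictOrderedRing N] [SuccAddOrder N] {E : N → S → Prop}

theorem SigmaInduction.exists_isMultiple [Nonempty S] (hI : SigmaInduction E 1) (a : N) :
    ∃ d : N, IsMultiple d a := by
  have hdef : SigmaDefinable E 1 (fun a => ∃ d : N, IsMultiple d a) :=
    ⟨exN (Fml.and (le one (var 0))
        (ballN (var 1) (imp (le one (var 0)) (Fml.dvd (var 0) (var 1))))),
      0, Classical.arbitrary _,
      .ex (IsDelta0.isSigma_one (by simp (maxDischargeDepth := 9))), by simp [IsMultiple]⟩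
  refine hI _ hdef ⟨1, le_rfl, fun k hk hk' => ?_⟩ (fun x ⟨d, hd, h⟩ => ?_) a
  · exact absurd (hk'.trans hk) zero_lt_one.not_ge
  · refine ⟨d * (x + 1), one_le_mul hd le_add_self, fun k hk hk' => ?_⟩
    obtain hlt | rfl := hk.lt_or_eq
    · exact (h k (Order.lt_add_one_iff.1 hlt) hk').mul_right _
    · exact dvd_mul_left _ _

theorem SigmaInduction.exists_full_code [Nonempty S] (hI : SigmaInduction E 1) (d a : N) :
    ∃ c : N, 1 ≤ c ∧ ∀ x ≤ a, CodeMem x c d := by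
  have hdef : SigmaDefinable E 1 (fun a => ∃ c : N, 1 ≤ c ∧ ∀ x ≤ a, CodeMem x c d) :=
    ⟨exN (Fml.and (le one (var 0)) (ballN (var 1) (Fml.codeMem (var 0) (var 1) (var 3)))),
      scons d 0, Classical.arbitrary _,
      .ex (IsDelta0.isSigma_one (by simp (maxDischargeDepth := 9))), by simp⟩
  have one_le_modulus (x : N) : 1 ≤ 1 + (x + 1) * d := le_self_add
  refine hI _ hdef ⟨1 + (0 + 1) * d, one_le_modulus 0, fun x hx => ?_⟩ (fun a ⟨c, hc, h⟩ => ?_) a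
  · exact nonpos_iff_eq_zero.1 hx ▸ dvd_rfl
  · refine ⟨c * (1 + (a + 1 + 1) * d), one_le_mul hc (one_le_modulus _), fun x hx => ?_⟩
    obtain hlt | rfl := hx.lt_or_eq
    · exact Dvd.dvd.mul_right (h x (Order.lt_add_one_iff.1 hlt)) _
    · exact dvd_mul_left _ _

theorem SigmaInduction.exists_least {n : ℕ} (hI : SigmaInduction E n) {p : N → Prop} {m : N}
    (hdef : SigmaDefinable E n (fun x => ∃ c, c + x ≤ m ∧ p c)) (hm : p m) :
    ∃ c, p c ∧ ∀ c' < c, ¬ p c' := by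
  by_contra! hno
  have descent : ∃ c, c + (m + 1) ≤ m ∧ p c := by
    refine hI _ hdef ⟨m, (add_zero m).le, hm⟩ (fun x ⟨c, hc, hp⟩ => ?_) (m + 1)
    obtain ⟨c', hlt, hp'⟩ := hno c hp
    refine ⟨c', ?_, hp'⟩
    calc c' + (x + 1) = c' + 1 + x := by ring
      _ ≤ c + x := by gcongr; exact Order.add_one_le_of_lt hlt
      _ ≤ m := hc
  obtain ⟨c, hc, -⟩ := descent
  exact (le_add_self.trans hc).not_gt (lt_add_one m)

theorem SigmaInduction.exists_minimal (hI : SigmaInduction E 1) {a : N} {Q R : S}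
    (bound : ∀ x, E x Q → x ≤ a)
    (antisymm : ∀ x y, E x Q → E y Q → E (pr x y) R → E (pr y x) R → x = y)
    (trans : ∀ x y z, E x Q → E y Q → E z Q → E (pr x y) R → E (pr y z) R → E (pr x z) R)
    (nonempty : ∃ x, E x Q) : ∃ p, E p Q ∧ ∀ q, E q Q → E (pr q p) R → q = p := by
  have hdef : SigmaDefinable E 1
      (fun y => ∃ p, E p Q ∧ ∀ q < y, E q Q → E (pr q p) R → q = p) :=
    ⟨exN (Fml.and (mem (var 0) 0) (bltN (var 1) (imp (mem (var 0) 0)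
        (imp (mem (pair (var 0) (var 1)) 1) (eq (var 0) (var 1)))))),
      0, scons Q fun _ => R,
      .ex (IsDelta0.isSigma_one (by simp (maxDischargeDepth := 9))), by simp⟩
  have minimal_below : ∃ p, E p Q ∧ ∀ q < a + 1, E q Q → E (pr q p) R → q = p := by
    refine hI _ hdef ?_ (fun y ⟨p, hp, hmin⟩ => ?_) (a + 1)
    · exact nonempty.imp fun x hx => ⟨hx, fun q hq => absurd hq not_lt_zero⟩
    by_cases hy : E y Q ∧ E (pr y p) R
    · refine ⟨y, hy.1, fun q hlt hq hqy => ?_⟩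
      obtain hlt | rfl := (Order.lt_add_one_iff.1 hlt).lt_or_eq
      · obtain rfl := hmin q hlt hq (trans q y p hq hy.1 hp hqy hy.2)
        exact antisymm q y hq hy.1 hqy hy.2
      · rfl
    · refine ⟨p, hp, fun q hlt hq hqp => ?_⟩
      obtain hlt | rfl := (Order.lt_add_one_iff.1 hlt).lt_or_eq
      · exact hmin q hlt hq hqp
      · exact absurd ⟨hq, hqp⟩ hy
  obtain ⟨p, hp, hmin⟩ := minimal_below
  exact ⟨p, hp, fun q hq => hmin q (Order.lt_add_one_iff.2 (bound q hq)) hq⟩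

end Induction

/-! ### Recurrent colours -/

section Recurrent

variable {N S : Type} [CommSemiring N] [LinearOrder N] {E : N → S → Prop}

/-- The colour `x` occurs in `C` on a pair of numbers beyond `b`. -/
def OccursAfter (E : N → S → Prop) (C : S) (b x : N) : Prop :=
  ∃ i j, b < i ∧ i < j ∧ E (pr (pr i j) x) C

/-- The colour `x` occurs in `C` arbitrarily late. -/
def Recurrent (E : N → S → Prop) (C : S) (x : N) : Prop := ∀ b, OccursAfter E C b x

/-- The set with code `c, d` contains all colours up to `a` which occur in `C` beyond `b`. -/
def Covers (E : N → S → Prop) (C : S) (a b c d : N) : Prop :=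
  ∀ x ≤ a, OccursAfter E C b x → CodeMem x c d

theorem OccursAfter.mono {C : S} {b b' x : N} (h : OccursAfter E C b' x) (hb : b ≤ b') :
    OccursAfter E C b x := by
  obtain ⟨i, j, hi, hij, hC⟩ := h
  exact ⟨i, j, hb.trans_lt hi, hij, hC⟩

variable [CanonicallyOrderedAdd N] [IsStrictOrderedRing N] [SuccAddOrder N]

theorem exists_covers_of_not_recurrent {C : S} {a b c d x : N} (hd : IsMultiple d a)
    (hc : 1 ≤ c) (hcov : Covers E C a b c d) (hx : x ≤ a) (hmem : CodeMem x c d)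
    (hrec : ¬ Recurrent E C x) : ∃ c' < c, 1 ≤ c' ∧ ∃ b', Covers E C a b' c' d := by
  obtain ⟨e, rfl⟩ := hmem
  obtain ⟨b', hb'⟩ := not_forall.1 hrec
  have he : 0 < e := pos_of_mul_pos_right (zero_lt_one.trans_le hc) zero_le
  refine ⟨e, lt_mul_of_one_lt_left he (one_lt_modulus hd.1 x), Order.one_le_iff_pos.2 he,
    max b b', fun y hy hocc => ?_⟩
  have hmem : CodeMem y (e * (1 + (x + 1) * d)) d :=
    mul_comm e _ ▸ hcov y hy (hocc.mono (le_max_left b b'))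
  refine ((codeMem_mul_iff hd hy hx).1 hmem).resolve_left ?_
  rintro rfl
  exact hb' (hocc.mono (le_max_right b b'))

theorem sigmaDefinable_covers (E : N → S → Prop) (C : S) (a d m : N) :
    SigmaDefinable E 2 fun y => ∃ c, c + y ≤ m ∧ 1 ≤ c ∧ ∃ b, Covers E C a b c d := by
  let ψ := Fml.and (le (add (var 4) (var 5)) (var 8)) (Fml.and (le one (var 4))
    (imp (le (var 2) (var 6)) (imp (Fml.lt (var 3) (var 1)) (imp (Fml.lt (var 1) (var 0))
      (imp (mem (triple (var 1) (var 0) (var 2)) 0) (Fml.codeMem (var 2) (var 4) (var 7)))))))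
  have hψ : IsDelta0 ψ := by simp (maxDischargeDepth := 9) [ψ]
  refine ⟨exN (exN (allN (allN (allN ψ)))), scons a (scons d (scons m 0)), fun _ => C,
    .ex (.ex (.ofPi (.all (.all (.all (.ofSigma (.zero _ hψ))))))), fun y => ?_⟩
  simp only [ψ, sat_exN, Fml.Sat, sat_and, sat_lt, sat_codeMem, eval_triple, NTerm.eval,
    scons_zero, scons_succ]
  constructor
  · rintro ⟨c, b, h⟩
    exact ⟨c, (h 0 0 0).1, (h 0 0 0).2.1, b,
      fun x hx ⟨i, j, hi, hij, hC⟩ => (h x i j).2.2 hx hi hij hC⟩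
  · rintro ⟨c, hle, hc, b, h⟩
    exact ⟨c, b, fun x i j => ⟨hle, hc, fun hx hi hij hC => h x hx ⟨i, j, hi, hij, hC⟩⟩⟩

/- Among the codes of sets which contain all colours occurring from some point on take the least
one. Removing a colour would lower the code, so all its colours are recurrent. -/
theorem SigmaInduction.exists_code_recurrent [Nonempty S] (hI : SigmaInduction E 1)
    (hI₂ : SigmaInduction E 2) (C : S) (a : N) :
    ∃ b c d, Covers E C a b c d ∧ ∀ x ≤ a, CodeMem x c d → Recurrent E C x := by
  obtain ⟨d, hd⟩ := hI.exists_isMultiple a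
  obtain ⟨m, hm, hfull⟩ := hI.exists_full_code d a
  obtain ⟨c, ⟨hc, b, hcov⟩, hleast⟩ :=
    hI₂.exists_least (sigmaDefinable_covers E C a d m) ⟨hm, 0, fun x hx _ => hfull x hx⟩
  refine ⟨b, c, d, hcov, fun x hx hmem => ?_⟩
  by_contra hrec
  obtain ⟨c', hlt, hc'⟩ := exists_covers_of_not_recurrent hd hc hcov hx hmem hrec
  exact hleast c' hlt hc'

theorem exists_recurrent_set (hI : SigmaInduction E 1) (hI₂ : SigmaInduction E 2)
    (hC : DeltaOneComprehension E) (C : S) (a : N) :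
    ∃ Q b, (∀ x, E x Q → x ≤ a ∧ Recurrent E C x) ∧ ∀ x ≤ a, OccursAfter E C b x → E x Q := by
  have : Nonempty S := ⟨C⟩
  obtain ⟨b, c, d, hcov, hrec⟩ := hI.exists_code_recurrent hI₂ C a
  have hdef : DeltaOneDefinable E (fun x => x ≤ a ∧ CodeMem x c d) :=
    IsDelta0.deltaOneDefinable
      (φ := Fml.and (le (var 0) (var 1)) (Fml.codeMem (var 0) (var 2) (var 3))) (by simp)
      (scons a (scons c (scons d 0))) (fun _ => C) (by simp)
  obtain ⟨Q, hQ⟩ := hC _ hdef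
  exact ⟨Q, b, fun x hx => ⟨((hQ x).1 hx).1, hrec x ((hQ x).1 hx).1 ((hQ x).1 hx).2⟩,
    fun x hx hocc => (hQ x).2 ⟨hx, hcov x hx hocc⟩⟩

end Recurrent

/-! ### Greedy subsets -/

section Greedy

variable {N S : Type} [CommSemiring N] [LinearOrder N] {E : N → S → Prop} {A B : S}

/-- Below `z`, the predicate `p` is the greedy subset of `A` for the compatibility relation `B`:
an element of `A` belongs to it if it is compatible with all its smaller elements. -/
def IsGreedyBelow (E : N → S → Prop) (A B : S) (z : N) (p : N → Prop) : Prop :=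
  ∀ y < z, p y ↔ E y A ∧ ∀ e < y, p e → E (pr e y) B

theorem IsGreedyBelow.mono {z z' : N} {p : N → Prop} (h : IsGreedyBelow E A B z' p)
    (hz : z ≤ z') : IsGreedyBelow E A B z p :=
  fun y hy => h y (hy.trans_le hz)

theorem IsGreedyBelow.congr {z : N} {p q : N → Prop} (h : IsGreedyBelow E A B z p)
    (hpq : ∀ y < z, p y ↔ q y) : IsGreedyBelow E A B z q := by
  intro y hy
  rw [← hpq y hy, h y hy]
  exact and_congr_right fun _ => forall₂_congr fun e he => by rw [hpq e (he.trans hy)]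

/-- The formula `IsGreedyBelow E A B z (CodeMem · c d)`, where `A` and `B` are the set variables
`0` and `1`. -/
def greedyBelow (c d z : NTerm) : Fml :=
  bltN z (Fml.iff (Fml.codeMem (var 0) c.shift d.shift) (Fml.and (mem (var 0) 0)
    (bltN (var 0) (imp (Fml.codeMem (var 0) c.shift.shift d.shift.shift)
      (mem (pair (var 0) (var 1)) 1)))))

@[simp]
theorem IsDelta0.greedyBelow (c d z : NTerm) : IsDelta0 (greedyBelow c d z) := by
  simp (maxDischargeDepth := 9) [SOA.greedyBelow]

variable [CanonicallyOrderedAdd N] [IsStrictOrderedRing N] [SuccAddOrder N]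

theorem isGreedyBelow_add_one {z : N} {p : N → Prop} :
    IsGreedyBelow E A B (z + 1) p ↔
      IsGreedyBelow E A B z p ∧ (p z ↔ E z A ∧ ∀ e < z, p e → E (pr e z) B) := by
  refine ⟨fun h => ⟨h.mono (le_add_right le_rfl), h z (lt_add_one z)⟩, fun ⟨h, hz⟩ y hy => ?_⟩
  obtain hlt | rfl := (Order.lt_add_one_iff.1 hy).lt_or_eq
  · exact h y hlt
  · exact hz

@[simp]
theorem sat_greedyBelow (v : ℕ → N) (s : ℕ → S) (c d z : NTerm) :
    (greedyBelow c d z).Sat E v s ↔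
      IsGreedyBelow E (s 0) (s 1) (z.eval v) (CodeMem · (c.eval v) (d.eval v)) := by
  simp [greedyBelow, IsGreedyBelow]

/- Stage `x` of the construction: the code has no elements between `x` and `z`. -/
theorem exists_greedy_code_succ {c d x z : N} (hd : IsMultiple d z) (hx : x ≤ z)
    (hgreedy : IsGreedyBelow E A B x (CodeMem · c d))
    (hlt : ∀ y ≤ z, CodeMem y c d → y < x) :
    ∃ c', IsGreedyBelow E A B (x + 1) (CodeMem · c' d) ∧
      ∀ y ≤ z, CodeMem y c' d → y < x + 1 := by
  have hx_notMem : ¬ CodeMem x c d := fun h => (hlt x hx h).false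
  by_cases hadd : E x A ∧ ∀ e < x, CodeMem e c d → E (pr e x) B
  · have mem_iff {y : N} (hy : y ≤ z) :
        CodeMem y (c * (1 + (x + 1) * d)) d ↔ y = x ∨ CodeMem y c d := codeMem_mul_iff hd hy hx
    have mem_iff_of_lt {y : N} (hy : y < x) :
        CodeMem y c d ↔ CodeMem y (c * (1 + (x + 1) * d)) d := by
      simp [mem_iff (hy.le.trans hx), hy.ne]
    refine ⟨c * (1 + (x + 1) * d), isGreedyBelow_add_one.2
      ⟨hgreedy.congr fun y => mem_iff_of_lt, iff_of_true ((mem_iff hx).2 (.inl rfl)) ?_⟩, ?_⟩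
    · exact ⟨hadd.1, fun e he h => hadd.2 e he ((mem_iff_of_lt he).2 h)⟩
    · intro y hy h
      obtain rfl | h := (mem_iff hy).1 h
      · exact lt_add_one y
      · exact (hlt y hy h).trans (lt_add_one x)
  · exact ⟨c, isGreedyBelow_add_one.2 ⟨hgreedy, iff_of_false hx_notMem hadd⟩,
      fun y hy h => (hlt y hy h).trans (lt_add_one x)⟩

theorem SigmaInduction.exists_greedy_code (hI : SigmaInduction E 1) (A B : S) (z : N) :
    ∃ c d, IsGreedyBelow E A B z (CodeMem · c d) := by
  have : Nonempty S := ⟨A⟩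
  obtain ⟨d, hd⟩ := hI.exists_isMultiple z
  have hdef : SigmaDefinable E 1 (fun x => ∃ c, x ≤ z →
      IsGreedyBelow E A B x (CodeMem · c d) ∧ ∀ y ≤ z, CodeMem y c d → y < x) :=
    ⟨exN (imp (le (var 1) (var 2)) (Fml.and (greedyBelow (var 0) (var 3) (var 1))
        (ballN (var 2) (imp (Fml.codeMem (var 0) (var 1) (var 4)) (Fml.lt (var 0) (var 2)))))),
      scons z (scons d 0), scons A fun _ => B,
      .ex (IsDelta0.isSigma_one (by simp (maxDischargeDepth := 9))), by simp⟩
  have stage := hI _ hdef ⟨1, fun _ => ⟨fun y hy => absurd hy not_lt_zero,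
    fun y _ h => absurd h (not_codeMem_one hd.1 y)⟩⟩ ?_ z
  · obtain ⟨c, hc⟩ := stage
    exact ⟨c, d, (hc le_rfl).1⟩
  · rintro x ⟨c, hc⟩
    by_cases hx : x + 1 ≤ z
    · have hxz : x ≤ z := (le_add_right le_rfl).trans hx
      obtain ⟨hgreedy, hlt⟩ := hc hxz
      exact (exists_greedy_code_succ hd hxz hgreedy hlt).imp fun c' hc' _ => hc'
    · exact ⟨c, fun h => absurd h hx⟩

theorem SigmaInduction.greedy_code_unique (hI : SigmaInduction E 1) {c d c' d' z : N}
    (h : IsGreedyBelow E A B z (CodeMem · c d)) (h' : IsGreedyBelow E A B z (CodeMem · c' d')) :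
    ∀ y < z, CodeMem y c d ↔ CodeMem y c' d' := by
  have hdef : SigmaDefinable E 1
      (fun x => ∀ y < x, y < z → (CodeMem y c d ↔ CodeMem y c' d')) :=
    ⟨bltN (var 0) (imp (Fml.lt (var 0) (var 2))
        (Fml.iff (Fml.codeMem (var 0) (var 3) (var 4)) (Fml.codeMem (var 0) (var 5) (var 6)))),
      scons z (scons c (scons d (scons c' (scons d' 0)))), fun _ => A,
      IsDelta0.isSigma_one (by simp (maxDischargeDepth := 9)), by simp⟩
  refine fun y hy => hI _ hdef (fun y hy => absurd hy not_lt_zero) (fun x ih y hyx hyz => ?_) z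
    y hy hy
  refine (h y hyz).trans (Iff.trans ?_ (h' y hyz).symm)
  exact and_congr_right fun _ => forall₂_congr fun e he =>
    imp_congr_left (ih e (he.trans_le (Order.lt_add_one_iff.1 hyx)) (he.trans hyz))

/- An element `y` belongs to the greedy subset if this holds for some, equivalently every, code of
the greedy subset below `y + 1`. -/
theorem exists_greedy_set (hI : SigmaInduction E 1) (hC : DeltaOneComprehension E) (A B : S) :
    ∃ Z, ∀ y, E y Z ↔ E y A ∧ ∀ e < y, E e Z → E (pr e y) B := by
  have hdef : DeltaOneDefinable E
      (fun y => ∃ c d, IsGreedyBelow E A B (y + 1) (CodeMem · c d) ∧ CodeMem y c d) := by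
    refine ⟨exN (exN (Fml.and (greedyBelow (var 1) (var 0) (add (var 2) one))
        (Fml.codeMem (var 2) (var 1) (var 0)))),
      exN (exN (Fml.and (greedyBelow (var 1) (var 0) (add (var 2) one))
        (neg (Fml.codeMem (var 2) (var 1) (var 0))))),
      0, scons A fun _ => B, .ex (.ex (IsDelta0.isSigma_one (by simp))),
      .ex (.ex (IsDelta0.isSigma_one (by simp))), by simp, fun y => ?_⟩
    simp only [sat_exN, sat_and, sat_neg, sat_greedyBelow, sat_codeMem, NTerm.eval, scons_zero,
      scons_succ]
    constructor
    · rintro ⟨c, d, h, hy⟩ ⟨c', d', h', hy'⟩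
      exact hy ((hI.greedy_code_unique h h' y (lt_add_one y)).2 hy')
    · intro hno
      obtain ⟨c, d, h⟩ := hI.exists_greedy_code A B (y + 1)
      exact ⟨c, d, h, fun hy => hno ⟨c, d, h, hy⟩⟩
  obtain ⟨Z, hZ⟩ := hC _ hdef
  refine ⟨Z, fun y => ?_⟩
  obtain ⟨c, d, h⟩ := hI.exists_greedy_code A B (y + 1)
  refine h.congr (q := (E · Z)) (fun e he => ?_) y (lt_add_one y)
  rw [hZ]
  have he : e + 1 ≤ y + 1 := Order.add_one_le_of_lt he
  refine ⟨fun hmem => ⟨c, d, h.mono he, hmem⟩, fun ⟨c', d', h', hmem⟩ => ?_⟩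
  exact (hI.greedy_code_unique h' (h.mono he) e (lt_add_one e)).1 hmem

end Greedy

/-! ### Disjoint intervals -/

section DisjointIntervals

variable {N S : Type} [CommSemiring N] [LinearOrder N] {E : N → S → Prop}

/-- The pairs in `Z` are the end points of intervals which lie one after the other. -/
structure DisjointIntervals (E : N → S → Prop) (Z : S) : Prop where
  lt {i j : N} : E (pr i j) Z → i < j
  eq_or_lt {i j i' j' : N} : E (pr i j) Z → E (pr i' j') Z → (i = i' ∧ j = j') ∨ j < i' ∨ j' < i

theorem DisjointIntervals.lt_of_lt {Z : S} (hZ : DisjointIntervals E Z) {i j i' j' : N}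
    (h : E (pr i j) Z) (h' : E (pr i' j') Z) (hi : i < i') : j < i' := by
  have := hZ.lt h'
  obtain ⟨rfl, -⟩ | hlt | hlt := hZ.eq_or_lt h h' <;> order

/- If `i` is not a first component, then this is witnessed by an interval beyond `i`: its end point
bounds the second component of a pair `(i, j)` in `Z`. -/
theorem DisjointIntervals.exists_first_components (hC : DeltaOneComprehension E) {Z : S}
    (hZ : DisjointIntervals E Z) (hinf : ∀ m, ∃ i j, m < i ∧ E (pr i j) Z) :
    ∃ I, ∀ i, E i I ↔ ∃ j, E (pr i j) Z := by
  refine hC _ ⟨exN (mem (pair (var 1) (var 0)) 0),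
    exN (exN (Fml.and (Fml.lt (var 2) (var 1)) (Fml.and (mem (pair (var 1) (var 0)) 0)
      (ballN (var 0) (neg (mem (pair (var 3) (var 0)) 0)))))), 0, fun _ => Z,
    .ex (IsDelta0.isSigma_one (by simp)),
    .ex (.ex (IsDelta0.isSigma_one (by simp (maxDischargeDepth := 9)))), by simp, fun i => ?_⟩
  simp only [sat_exN, sat_and, sat_lt, sat_ballN, sat_neg, Fml.Sat, eval_pair, NTerm.eval,
    scons_zero, scons_succ]
  constructor
  · rintro ⟨i', j', hi, h', hno⟩ ⟨j, h⟩
    exact hno j ((hZ.lt_of_lt h h' hi).trans (hZ.lt h')).le h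
  · intro hno
    obtain ⟨i', j', hi, h'⟩ := hinf i
    exact ⟨i', j', hi, h', fun j _ h => hno ⟨j, h⟩⟩

variable [IsStrictOrderedRing N]

theorem DisjointIntervals.exists_lt {Z : S} (hZ : DisjointIntervals E Z)
    (hinf : ∀ n, ∃ i j, n ≤ j ∧ E (pr i j) Z) (m : N) : ∃ i j, m < i ∧ E (pr i j) Z := by
  obtain ⟨i, j, hm, h⟩ := hinf m
  obtain ⟨i', j', hj, h'⟩ := hinf (j + 1)
  have hjj' : j < j' := (lt_add_one j).trans_le hj
  refine ⟨i', j', hm.trans_lt ?_, h'⟩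
  obtain ⟨-, rfl⟩ | hlt | hlt := hZ.eq_or_lt h h'
  · exact absurd hjj' (lt_irrefl j)
  · exact hlt
  · exact absurd (hlt.trans (hZ.lt h)) hjj'.not_gt

variable [CanonicallyOrderedAdd N] [SuccAddOrder N]

theorem DeltaOneComprehension.exists_before [Nonempty S] (hC : DeltaOneComprehension E) :
    ∃ B, ∀ i j i' j', E (pr (pr i j) (pr i' j')) B ↔ j < i' := by
  have hdef : DeltaOneDefinable E
      (fun x => ∃ i ≤ x, ∃ j ≤ x, ∃ i' ≤ x, ∃ j' ≤ x, x = pr (pr i j) (pr i' j') ∧ j < i') :=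
    IsDelta0.deltaOneDefinable
      (φ := bexN (var 0) (bexN (var 1) (bexN (var 2) (bexN (var 3)
        (Fml.and (eq (var 4) (pair (pair (var 3) (var 2)) (pair (var 1) (var 0))))
          (Fml.lt (var 2) (var 1)))))))
      (by simp (maxDischargeDepth := 9)) 0 (Classical.arbitrary _) (by simp)
  obtain ⟨B, hB⟩ := hC _ hdef
  refine ⟨B, fun i j i' j' => (hB _).trans ⟨?_, fun hlt => ?_⟩⟩
  · rintro ⟨_, -, _, -, _, -, _, -, heq, hlt⟩
    simp only [pr_inj] at heq
    obtain ⟨⟨rfl, rfl⟩, rfl, rfl⟩ := heq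
    exact hlt
  · have hl := le_pr_left (pr i j) (pr i' j')
    have hr := le_pr_right (pr i j) (pr i' j')
    exact ⟨i, (le_pr_left i j).trans hl, j, (le_pr_right i j).trans hl,
      i', (le_pr_left i' j').trans hr, j', (le_pr_right i' j').trans hr, rfl, hlt⟩

theorem DeltaOneComprehension.exists_colour_pairs (hC : DeltaOneComprehension E) (C : S)
    (b p : N) :
    ∃ A, ∀ x, E x A ↔ ∃ i j, b < i ∧ i < j ∧ x = pr i j ∧ E (pr (pr i j) p) C := by
  have hdef : DeltaOneDefinable E
      (fun x => ∃ i ≤ x, ∃ j ≤ x, b < i ∧ i < j ∧ x = pr i j ∧ E (pr (pr i j) p) C) :=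
    IsDelta0.deltaOneDefinable
      (φ := bexN (var 0) (bexN (var 1) (Fml.and (Fml.lt (var 3) (var 1))
        (Fml.and (Fml.lt (var 1) (var 0)) (Fml.and (eq (var 2) (pair (var 1) (var 0)))
          (mem (triple (var 1) (var 0) (var 4)) 0))))))
      (by simp (maxDischargeDepth := 9)) (scons b (scons p 0)) (fun _ => C) (by simp)
  obtain ⟨A, hA⟩ := hC _ hdef
  refine ⟨A, fun x => (hA x).trans ⟨?_, ?_⟩⟩
  · rintro ⟨i, -, j, -, h⟩
    exact ⟨i, j, h⟩
  · rintro ⟨i, j, hi, hij, rfl, h⟩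
    exact ⟨i, le_pr_left i j, j, le_pr_right i j, hi, hij, rfl, h⟩

theorem exists_disjointIntervals (hI : SigmaInduction E 1) (hC : DeltaOneComprehension E) {A : S}
    (hA : ∀ x, E x A → ∃ i j, i < j ∧ x = pr i j) (hinf : ∀ m, ∃ i j, m < i ∧ E (pr i j) A) :
    ∃ Z, DisjointIntervals E Z ∧ (∀ x, E x Z → E x A) ∧ ∀ m, ∃ i j, m < i ∧ E (pr i j) Z := by
  have : Nonempty S := ⟨A⟩
  obtain ⟨B, hB⟩ := hC.exists_before
  obtain ⟨Z, hZ⟩ := exists_greedy_set hI hC A B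
  have hsub (x : N) (hx : E x Z) : E x A := ((hZ x).1 hx).1
  have hdisj : DisjointIntervals E Z := by
    refine ⟨fun {i j} h => ?_, fun {i j i' j'} h h' => ?_⟩
    · obtain ⟨_, _, hlt, heq⟩ := hA _ (hsub _ h)
      obtain ⟨rfl, rfl⟩ := pr_inj.1 heq
      exact hlt
    · obtain hlt | heq | hlt := lt_trichotomy (pr i j) (pr i' j')
      · exact .inr (.inl ((hB ..).1 (((hZ _).1 h').2 _ hlt h)))
      · exact .inl (pr_inj.1 heq)
      · exact .inr (.inr ((hB ..).1 (((hZ _).1 h).2 _ hlt h')))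
  refine ⟨Z, hdisj, hsub, hdisj.exists_lt fun n => ?_⟩
  obtain ⟨i, j, hn, hij⟩ := hinf n
  by_cases hmem : E (pr i j) Z
  · exact ⟨i, j, hn.le.trans (hdisj.lt hmem).le, hmem⟩
  -- The pair `(i, j)` was rejected because of a pair `(i', j')` in `Z` with `i ≤ j'`.
  · have hrej : ∃ e < pr i j, E e Z ∧ ¬ E (pr e (pr i j)) B := by
      by_contra! hno
      exact hmem ((hZ _).2 ⟨hij, hno⟩)
    obtain ⟨e, -, heZ, heB⟩ := hrej
    obtain ⟨i', j', -, rfl⟩ := hA e (hsub e heZ)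
    rw [hB, not_lt] at heB
    exact ⟨i', j', hn.le.trans heB, heZ⟩

theorem exists_thin_set (hI : SigmaInduction E 1) (hC : DeltaOneComprehension E) {A : S}
    (hA : ∀ x, E x A → ∃ i j, i < j ∧ x = pr i j) (hinf : ∀ m, ∃ i j, m < i ∧ E (pr i j) A) :
    ∃ I, (∀ m, ∃ i, m < i ∧ E i I) ∧
      ∀ i i', E i I → E i' I → i < i' → ∃ j < i', E (pr i j) A := by
  obtain ⟨Z, hZ, hsub, hunbdd⟩ := exists_disjointIntervals hI hC hA hinf
  obtain ⟨I, hI⟩ := hZ.exists_first_components hC hunbdd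
  refine ⟨I, fun m => ?_, fun i i' hi hi' hlt => ?_⟩
  · obtain ⟨i, j, hm, h⟩ := hunbdd m
    exact ⟨i, hm, (hI i).2 ⟨j, h⟩⟩
  · obtain ⟨j, h⟩ := (hI i).1 hi
    obtain ⟨j', h'⟩ := (hI i').1 hi'
    exact ⟨j, hZ.lt_of_lt h h' hlt, hsub _ h⟩

end DisjointIntervals

/-! ### Homogeneous sets -/

section Homogeneous

variable {N S : Type} [CommSemiring N] [LinearOrder N] {E : N → S → Prop}

/-- `C` colours the pairs `i < j` by elements of the bounded set `P`, on which `R` is antisymmetric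
and transitive, and `C (i, j) ⪰ C (i, k)` for `i < j < k`. -/
structure IsOrderedColouring (E : N → S → Prop) (P R C : S) : Prop where
  bounded : ∃ a, ∀ x, E x P → x ≤ a
  antisymm : ∀ x y, E x P → E y P → E (pr x y) R → E (pr y x) R → x = y
  trans : ∀ x y z, E x P → E y P → E z P → E (pr x y) R → E (pr y z) R → E (pr x z) R
  exists_colour : ∀ i j, i < j →
    ∃ p, E p P ∧ E (pr (pr i j) p) C ∧ ∀ q, E (pr (pr i j) q) C → q = p
  ordered : ∀ i j k p q, i < j → j < k → E (pr (pr i j) p) C → E (pr (pr i k) q) C → E (pr q p) R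

theorem IsOrderedColouring.mem {P R C : S} (h : IsOrderedColouring E P R C) {i j p : N}
    (hij : i < j) (hp : E (pr (pr i j) p) C) : E p P := by
  obtain ⟨q, hq, -, huniq⟩ := h.exists_colour i j hij
  exact huniq p hp ▸ hq

variable [CanonicallyOrderedAdd N] [IsStrictOrderedRing N] [SuccAddOrder N]

/- A minimal one among the recurrent colours cannot decrease any further, since from some point on
only recurrent colours occur. -/
theorem IsOrderedColouring.exists_stable_colour (hI : SigmaInduction E 1)
    (hI₂ : SigmaInduction E 2) (hC : DeltaOneComprehension E) {P R C : S}
    (h : IsOrderedColouring E P R C) :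
    ∃ p b, Recurrent E C p ∧ ∀ i j k q, b < i → i < j → j < k → E (pr (pr i j) p) C →
      E (pr (pr i k) q) C → q = p := by
  obtain ⟨a, ha⟩ := h.bounded
  obtain ⟨Q, b, hrec, hcov⟩ := exists_recurrent_set hI hI₂ hC C a
  have hQP (x : N) (hx : E x Q) : E x P := by
    obtain ⟨i, j, -, hij, hx⟩ := (hrec x hx).2 0
    exact h.mem hij hx
  have hPQ {i j x : N} (hi : b < i) (hij : i < j) (hx : E (pr (pr i j) x) C) : E x Q :=
    hcov x (ha x (h.mem hij hx)) ⟨i, j, hi, hij, hx⟩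
  have nonempty : ∃ x, E x Q := by
    obtain ⟨x, -, hx, -⟩ := h.exists_colour (b + 1) (b + 1 + 1) (lt_add_one _)
    exact ⟨x, hPQ (lt_add_one b) (lt_add_one _) hx⟩
  obtain ⟨p, hp, hmin⟩ := hI.exists_minimal (R := R) (fun x hx => (hrec x hx).1)
    (fun x y hx hy => h.antisymm x y (hQP x hx) (hQP y hy))
    (fun x y z hx hy hz => h.trans x y z (hQP x hx) (hQP y hy) (hQP z hz)) nonempty
  exact ⟨p, b, (hrec p hp).2, fun i j k q hi hij hjk hp hq =>
    hmin q (hPQ hi (hij.trans hjk) hq) (h.ordered i j k p q hij hjk hp hq)⟩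

theorem IsOrderedColouring.exists_homogeneous (hI : SigmaInduction E 1)
    (hI₂ : SigmaInduction E 2) (hC : DeltaOneComprehension E) {P R C : S}
    (h : IsOrderedColouring E P R C) :
    ∃ I, (∀ m, ∃ i, m < i ∧ E i I) ∧
      ∃ p, ∀ i k q, E i I → E k I → i < k → E (pr (pr i k) q) C → q = p := by
  obtain ⟨p, b, hrec, hstable⟩ := h.exists_stable_colour hI hI₂ hC
  obtain ⟨A, hA⟩ := hC.exists_colour_pairs C b p
  have hApair (x : N) (hx : E x A) : ∃ i j, i < j ∧ x = pr i j := by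
    obtain ⟨i, j, -, hij, heq, -⟩ := (hA x).1 hx
    exact ⟨i, j, hij, heq⟩
  have hAinf (m : N) : ∃ i j, m < i ∧ E (pr i j) A := by
    obtain ⟨i, j, hi, hij, hp⟩ := hrec (max m b)
    exact ⟨i, j, (le_max_left m b).trans_lt hi,
      (hA _).2 ⟨i, j, (le_max_right m b).trans_lt hi, hij, rfl, hp⟩⟩
  obtain ⟨I, hunbdd, hthin⟩ := exists_thin_set hI hC hApair hAinf
  refine ⟨I, hunbdd, p, fun i k q hi hk hik hq => ?_⟩
  obtain ⟨j, hjk, hj⟩ := hthin i k hi hk hik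
  obtain ⟨_, _, hbi, hij, heq, hp⟩ := (hA _).1 hj
  obtain ⟨rfl, rfl⟩ := pr_inj.1 heq
  exact hstable i j k q hbi hij hjk hp hq

theorem sat_orderedRamsey (hI : SigmaInduction E 1) (hI₂ : SigmaInduction E 2)
    (hC : DeltaOneComprehension E) (v : ℕ → N) (s : ℕ → S) : orderedRamsey.Sat E v s := by
  simp only [orderedRamsey, finiteSet, partialOrderOn, colouring, orderedColouring, infiniteSet,
    homogeneous, sat_exN, sat_exS, sat_and, sat_lt, eval_triple, eval_pair, Fml.Sat, NTerm.eval,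
    scons]
  rintro P R C ⟨bounded, ⟨-, antisymm, trans⟩, exists_colour, ordered⟩
  have h : IsOrderedColouring E P R C := ⟨bounded, antisymm, trans, exists_colour, ordered⟩
  obtain ⟨I, hunbdd, p, hp⟩ := h.exists_homogeneous hI hI₂ hC
  exact ⟨I, hunbdd, fun i j i' j' q q' hi hj hij hi' hj' hij' hq hq' =>
    (hp i j q hi hj hij hq).trans (hp i' j' q' hi' hj' hij' hq').symm⟩

end Homogeneous

/-! ### The number sort of a model -/

section BasicAxioms

variable {N S : Type} {E : N → S → Prop}

theorem Models.sat_basicAxiom [Zero N] [One N] [Add N] [Mul N] [LE N] [Nonempty S]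
    (h : Models {χ | BasicAxiom χ} E) {ψ : Fml} (hψ : BasicAxiom ψ) (a b c : N) :
    ψ.Sat E (scons a (scons b (scons c 0))) (Classical.arbitrary _) :=
  h ψ hψ _ _

/-- The semiring structure on the number sort of a model, with the given operations. -/
abbrev Models.commSemiring [Zero N] [One N] [Add N] [Mul N] [LE N] [Nonempty S]
    (h : Models {χ | BasicAxiom χ} E) : CommSemiring N :=
  have add_comm (a b : N) : a + b = b + a := h.sat_basicAxiom .add_comm a b 0
  have mul_comm (a b : N) : a * b = b * a := h.sat_basicAxiom .mul_comm a b 0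
  have add_zero (a : N) : a + 0 = a := h.sat_basicAxiom .add_zero a 0 0
  have mul_one (a : N) : a * 1 = a := h.sat_basicAxiom .mul_one a 0 0
  have mul_zero (a : N) : a * 0 = 0 := h.sat_basicAxiom .mul_zero a 0 0
  have mul_add (a b c : N) : a * (b + c) = a * b + a * c := h.sat_basicAxiom .mul_add a b c
  { add_assoc := h.sat_basicAxiom .add_assoc
    add_comm
    add_zero
    zero_add a := (add_comm 0 a).trans (add_zero a)
    mul_assoc := h.sat_basicAxiom .mul_assoc
    mul_comm
    mul_one
    one_mul a := (mul_comm 1 a).trans (mul_one a)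
    mul_zero
    zero_mul a := (mul_comm 0 a).trans (mul_zero a)
    left_distrib := mul_add
    right_distrib a b c := by rw [mul_comm, mul_add, mul_comm c a, mul_comm c b]
    nsmul := nsmulRec }

/-- The order on the number sort of a model, with the given relation `≤`. -/
noncomputable abbrev Models.linearOrder [Zero N] [One N] [Add N] [Mul N] [LE N] [Nonempty S]
    (h : Models {χ | BasicAxiom χ} E) : LinearOrder N where
  le_refl a := h.sat_basicAxiom .le_refl a 0 0
  le_trans := h.sat_basicAxiom .le_trans
  le_antisymm a b := h.sat_basicAxiom .le_antisymm a b 0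
  le_total a b := (sat_or E _ _ _ _).1 (h.sat_basicAxiom .le_total a b 0)
  toDecidableLE := Classical.decRel _

variable [CommSemiring N] [LinearOrder N] [Nonempty S]

theorem Models.isStrictOrderedRing (h : Models {χ | BasicAxiom χ} E) :
    IsStrictOrderedRing N := by
  have zero_lt_one : (0 : N) < 1 := by simpa using h.sat_basicAxiom .zero_lt_one 0 0 0
  have add_lt_add {a b : N} (hab : a < b) (c : N) : a + c < b + c := by
    have := h.sat_basicAxiom .add_lt_add a b c
    simp only [Fml.Sat, sat_lt, NTerm.eval, scons] at this
    exact this hab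
  have mul_lt_mul {a b c : N} (hc : 0 < c) (hab : a < b) : a * c < b * c := by
    have := h.sat_basicAxiom .mul_lt_mul a b c
    simp only [Fml.Sat, sat_lt, NTerm.eval, scons] at this
    exact this hab hc
  have add_strictMono (c : N) : StrictMono (· + c) := fun _ _ hab => add_lt_add hab c
  exact
    { add_le_add_left _ _ hab c := (add_strictMono c).monotone hab
      le_of_add_le_add_left c a b hab :=
        (add_strictMono c).le_iff_le.1 (by simpa only [add_comm c] using hab)
      zero_le_one := zero_lt_one.le
      exists_pair_ne := ⟨0, 1, zero_lt_one.ne⟩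
      mul_lt_mul_of_pos_left c hc a b hab := by simpa only [mul_comm c] using mul_lt_mul hc hab
      mul_lt_mul_of_pos_right c hc a b hab := mul_lt_mul hc hab }

variable [IsStrictOrderedRing N]

theorem Models.canonicallyOrderedAdd (h : Models {χ | BasicAxiom χ} E) :
    CanonicallyOrderedAdd N where
  exists_add_of_le {a b} hab := by
    obtain ⟨c, hc⟩ := (sat_exN ..).1 (h.sat_basicAxiom .subtraction a b 0 hab)
    exact ⟨c, hc.symm⟩
  le_add_self a b := le_add_of_nonneg_left (h.sat_basicAxiom .zero_le b 0 0)
  le_self_add a b := le_add_of_nonneg_right (h.sat_basicAxiom .zero_le b 0 0)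

/-- By discreteness of the order, `x + 1` is the successor of `x`. -/
abbrev Models.succAddOrder (h : Models {χ | BasicAxiom χ} E) : SuccAddOrder N :=
  have one_le_of_pos {c : N} (hc : 0 < c) : 1 ≤ c := by
    have := h.sat_basicAxiom .discrete c 0 0
    simp only [Fml.Sat, sat_lt, NTerm.eval, scons] at this
    exact this hc
  have add_one_le_iff {a b : N} : a + 1 ≤ b ↔ a < b := by
    have := h.canonicallyOrderedAdd
    refine ⟨(lt_add_one a).trans_le, fun hab => ?_⟩
    obtain ⟨c, hc, rfl⟩ := exists_pos_add_of_lt' hab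
    gcongr
    exact one_le_of_pos hc
  { SuccOrder.ofSuccLeIff (· + 1) add_one_le_iff with
    succ_eq_add_one _ := rfl }

end BasicAxioms

theorem entails_orderedRamsey : Entails (RCA0 ∪ SigmaIND 2) orderedRamsey := by
  intro N S _ _ _ _ _ _ E h v s
  have basic : Models {χ | BasicAxiom χ} E := h.mono fun _ hχ => .inl (.inl (.inl hχ))
  have ind₁ : Models (SigmaIND 1) E := h.mono fun _ hχ => .inl (.inl (.inr hχ))
  have compr : Models Delta1CA E := h.mono fun _ hχ => .inl (.inr hχ)
  have ind₂ : Models (SigmaIND 2) E := h.mono fun _ hχ => .inr hχ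
  let _ := basic.commSemiring
  let _ := basic.linearOrder
  have := Models.isStrictOrderedRing (N := N) basic
  have := Models.canonicallyOrderedAdd (N := N) basic
  let _ := Models.succAddOrder (N := N) basic
  exact sat_orderedRamsey ind₁.sigmaInduction ind₂.sigmaInduction compr.deltaOneComprehension v s

end SOA

/-- Over `RCA₀`, the scheme `Σ⁰₂-IND` proves Ordered Ramsey's Theorem. -/
theorem mainTheorem4 : SOA.Proves (SOA.RCA0 ∪ SOA.SigmaIND 2) SOA.orderedRamsey :=
  SOA.entails_orderedRamsey.proves
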